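/- Let $D\subset\mathbb{R}^n$ ($n\ge 1$) be a bounded domain with Lipschitz boundary, and let $\{(\lambda_k,\phi_k)\}_{k\ge 1}$ be the eigenvalues (nondecreasing, repeated according to multiplicity) and $L^2(D)$-normalized eigenfunctions of $-\Delta$ on $D$ with zero Dirichlet boundary condition, the $\phi_k$ forming an orthonormal basis of $L^2(D)$. Let $s,\alpha,H\in(0,1)$, $T>0$, $h\in L^\infty([0,T])$, and let $W^H$ be a fractional Brownian motion with Hurst index $H$, that is, a centered Gaussian process with $\mathbb{E}[W^H(t)W^H(r)]=\tfrac12\left(t^{2H}+r^{2H}-|t-r|^{2H}\right)$ for $t,r\ge0$. Let $E_{\alpha,1}(z)=\sum_{j=0}^\infty z^j/\Gamma(j\alpha+1)$ be the Mittag-Leffler function. For a deterministic $q\in L^2(0,t)$, $\int_0^t q\,dW^H$ denotes the Wiener integral, that is, the $L^2(\Omega)$-limit of the integrals $\sum_i c_i W^H(a_i)$ of step functions $\sum_i c_i 1_{(0,a_i]}$, $a_i\le t$, that converge to $q$ in $L^2(0,t)$, where the step functions are such that this limit exists. Let $f,g\in L^2(D)$ with $\|g\|_{L^2(D)}\neq0$.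 Then the following hold. (i) There is a constant $C>0$ such that for all $t\in(0,T]$, all $k\ge1$ and all $\sigma_1\in[0,1]$ the function $r\mapsto E_{\alpha,1}(-\lambda_k^s(t-r)^\alpha)h(r)$ is integrable on $(0,t)$ and $$\left|\int_0^t E_{\alpha,1}(-\lambda_k^s(t-r)^\alpha)\,h(r)\,dr\right|\le C\lambda_k^{-\sigma_1 s}.$$ (ii) For all $t\in(0,T]$ and $k\ge1$ the Wiener integral $\int_0^t E_{\alpha,1}(-\lambda_k^s(t-r)^\alpha)\,dW^H(r)$ exists, and for every $\epsilon>0$ there is a constant $C>0$ such that for all $t\in(0,T]$, all $k,l\ge1$ and all $\sigma_2\in\left[0,\min\left(\tfrac H\alpha-\epsilon,1\right)\right]$ $$\mathbb{E}\left(\int_0^t E_{\alpha,1}(-\lambda_k^s(t-r)^\alpha)\,dW^H(r)\int_0^t E_{\alpha,1}(-\lambda_l^s(t-r)^\alpha)\,dW^H(r)\right)\le C\lambda_k^{-\sigma_2 s}\lambda_l^{-\sigma_2 s}.$$ -/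

import Mathlib

open MeasureTheory ProbabilityTheory Filter Topology TopologicalSpace
open scoped ENNReal NNReal

noncomputable section

namespace FracInverse

/-- The two-parameter Mittag-Leffler function `E_{α,β}(z) = ∑ₖ zᵏ / Γ(kα + β)` at a real argument. -/
def mittagLeffler (α β z : ℝ) : ℝ :=
  ∑' k : ℕ, z ^ k / Real.Gamma (k * α + β)

section Domain

variable {n : ℕ}

/-- Lipschitz boundary: near each boundary point there is a direction `ν` such that the set is the
region strictly above the graph, in direction `ν`, of a Lipschitz function of the component
`y - ⟪ν, y⟫ ν` orthogonal to `ν`. -/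
def HasLipschitzBoundary (D : Set (EuclideanSpace ℝ (Fin n))) : Prop :=
  ∀ x ∈ frontier D, ∃ (ν : EuclideanSpace ℝ (Fin n)) (γ : EuclideanSpace ℝ (Fin n) → ℝ) (K : ℝ≥0),
    ‖ν‖ = 1 ∧ LipschitzWith K γ ∧
      ∀ᶠ y in 𝓝 x, (y ∈ D ↔ γ (y - inner ℝ ν y • ν) < inner ℝ ν y)

/-- `u` belongs to `H¹₀(D)`, the closure of the test functions in `H¹(D)`, and `G` is its weak
gradient: some sequence of test functions converges to `u` in `L²(D)` while its gradients converge
to `G` in `L²(D)`. -/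
def IsH10WithGradient (D : Opens (EuclideanSpace ℝ (Fin n)))
    (u : EuclideanSpace ℝ (Fin n) → ℝ)
    (G : EuclideanSpace ℝ (Fin n) → EuclideanSpace ℝ (Fin n)) : Prop :=
  MemLp u 2 (volume.restrict (D : Set (EuclideanSpace ℝ (Fin n)))) ∧
  MemLp G 2 (volume.restrict (D : Set (EuclideanSpace ℝ (Fin n)))) ∧
  ∃ v : ℕ → TestFunction D ℝ (⊤ : ℕ∞),
    Tendsto (fun m => eLpNorm (fun x => v m x - u x) 2
      (volume.restrict (D : Set (EuclideanSpace ℝ (Fin n))))) atTop (𝓝 0) ∧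
    Tendsto (fun m => eLpNorm (fun x => gradient (v m) x - G x) 2
      (volume.restrict (D : Set (EuclideanSpace ℝ (Fin n))))) atTop (𝓝 0)

/-- `u` is a weak solution of `-Δu = μ u` in `D` with zero Dirichlet boundary condition. -/
def IsDirichletEigen (D : Opens (EuclideanSpace ℝ (Fin n))) (μ : ℝ)
    (u : EuclideanSpace ℝ (Fin n) → ℝ) : Prop :=
  ∃ G : EuclideanSpace ℝ (Fin n) → EuclideanSpace ℝ (Fin n), IsH10WithGradient D u G ∧
    ∀ v : TestFunction D ℝ (⊤ : ℕ∞),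
      ∫ x in (D : Set (EuclideanSpace ℝ (Fin n))), inner ℝ (G x) (gradient v x) =
        μ * ∫ x in (D : Set (EuclideanSpace ℝ (Fin n))), u x * v x

/-- `(lam k, φ k)`, for `k = 0, 1, 2, …`, is the full system of eigenpairs of the Dirichlet
Laplacian `-Δ` on `D`, repeated according to multiplicity: the eigenvalues are nondecreasing and
the eigenfunctions form an orthonormal basis of `L²(D)`. -/
structure IsDirichletEigensystem (D : Opens (EuclideanSpace ℝ (Fin n))) (lam : ℕ → ℝ)
    (φ : HilbertBasis ℕ ℝ
      (Lp ℝ 2 (volume.restrict (D : Set (EuclideanSpace ℝ (Fin n)))))) : Prop where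
  mono : Monotone lam
  eigen : ∀ k, IsDirichletEigen D (lam k) (φ k)

end Domain

section FBM

variable {Ω : Type*} [MeasurableSpace Ω]

/-- `W` is a one-dimensional fractional Brownian motion with Hurst index `H`: a centered Gaussian
process with covariance `(t^{2H} + r^{2H} - |t - r|^{2H}) / 2`. -/
structure IsFBM (P : Measure Ω) (H : ℝ) (W : ℝ≥0 → Ω → ℝ) : Prop where
  gaussian : IsGaussianProcess W P
  mean : ∀ t, ∫ ω, W t ω ∂P = 0
  covar : ∀ t r, ∫ ω, W t ω * W r ω ∂P =
    ((t : ℝ) ^ (2 * H) + (r : ℝ) ^ (2 * H) - |(t : ℝ) - r| ^ (2 * H)) / 2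

/-- The step function `∑ₐ c(a) 1_{(0,a]}`; every step function on `(0,t]` has this form, with
all `a ≤ t`. -/
def stepFun (c : ℝ≥0 →₀ ℝ) (r : ℝ) : ℝ :=
  c.sum fun a x => x * (Set.Ioc (0 : ℝ) a).indicator 1 r

/-- The integral `∑ₐ c(a) W(a)` of the step function `∑ₐ c(a) 1_{(0,a]}` with respect to `W`. -/
def stepIntegral (W : ℝ≥0 → Ω → ℝ) (c : ℝ≥0 →₀ ℝ) (ω : Ω) : ℝ :=
  c.sum fun a x => x * W a ω

/-- `J` is the Wiener integral `∫₀ᵗ q(r) dW(r)` of the deterministic integrand `q ∈ L²(0,t)`: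
the closure of the integral of step functions, as an operator from `L²(0,t)` to `L²(Ω)`.
For a fractional Brownian motion with Hurst index `H ∈ (0,1)` this operator is closable, so `J` is
unique up to almost sure equality; the integrand ranges over all of `L²(0,t)` if `H ≥ 1/2`, and over
the functions whose extension by zero is in the Sobolev space `H^{(1-2H)/2}(ℝ)` if `H < 1/2`. -/
def IsWienerIntegral (P : Measure Ω) (W : ℝ≥0 → Ω → ℝ) (t : ℝ≥0) (q : ℝ → ℝ) (J : Ω → ℝ) : Prop :=
  MemLp q 2 (volume.restrict (Set.Ioc (0 : ℝ) t)) ∧ MemLp J 2 P ∧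
  ∃ c : ℕ → ℝ≥0 →₀ ℝ, (∀ m, ∀ a ∈ (c m).support, a ≤ t) ∧
    Tendsto (fun m => eLpNorm (fun r => stepFun (c m) r - q r) 2
      (volume.restrict (Set.Ioc (0 : ℝ) t))) atTop (𝓝 0) ∧
    Tendsto (fun m => eLpNorm (fun ω => stepIntegral W (c m) ω - J ω) 2 P) atTop (𝓝 0)

end FBM

end FracInverse

end

/-! The kernel `q(r) = E_{α,1}(-μ(t-r)^α)`, with `μ = λ^s > 0`, is nondecreasing on `[0,t]`, takes
values in `[0,1]`, and is at most `e μ^{-σ} (t-r)^{-ασ}` for every `σ ∈ [0,1]`. Everything else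
follows from these properties. Integrating the last bound against a bounded `h` gives the
deterministic estimate, because `ασ ≤ α < 1`.

The properties of `E_{α,1}` come without contour integrals. Averaging over random scales multiplies
the `k`-th coefficient of the exponential series by a moment. After `n` averages of `exp(-cx)` with
`c = n^{1-α}`, Euler's product for Gamma shows that the coefficients converge to those of
`E_{α,1}(-x)` (`tendsto_expAverage`). Positivity, monotonicity and a bound `A/x` survive each
average, and the constants in the decay bound stay below `e`.

For the stochastic part, fractional Brownian motion is a curve in `L²(Ω)` with `‖w a - w b‖ =
|a-b|^H`. For monotone `q`, summation by parts bounds the norm of a left-endpoint sum by the sum for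
`∫ q d(-(t-r)^H)` (`IsFBMCurve.norm_leftStep_le`). With `q ≤ B(t-r)^{-κ}` and `κ < H` this is at
most `B H/(H-κ) t^{H-κ}`; no distinction between `H < 1/2` and `H ≥ 1/2` is needed. Dyadic sums are
Cauchy, so the integral exists. Closability (`IsFBMCurve.closable`) carries the bound over to every
version of the integral, and Cauchy–Schwarz bounds the covariance. Negative powers of `λ` require `λ
> 0`, which is the Poincaré inequality. -/

namespace FracInverse

/-! ### The Mittag-Leffler function on the negative half-line

For `0 < α < 1` the function `x ↦ E_{α,1}(-x)` is a pointwise limit of functions obtained from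
exponentials by averaging operators that preserve positivity, monotonicity and decay. -/

/-- The average of `y ↦ f (x * y)` against the mixture of the Dirac mass at `1`, of weight `α`, and
the law with density `(i + 1) y ^ i` on `[0, 1]`, of weight `1 - α`. -/
noncomputable def scaleAverage (α : ℝ) (i : ℕ) (f : ℝ → ℝ) (x : ℝ) : ℝ :=
  α * f x + (1 - α) * ∫ y in (0 : ℝ)..1, f (x * y) * ((i + 1) * y ^ i)

section ScaleAverage

variable {α : ℝ} {i : ℕ} {f : ℝ → ℝ}

lemma intervalIntegrable_scale (hf : Continuous f) (x : ℝ) :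
    IntervalIntegrable (fun y => f (x * y) * (((i : ℝ) + 1) * y ^ i)) volume 0 1 :=
  Continuous.intervalIntegrable (by fun_prop) _ _

lemma continuous_scaleAverage (hf : Continuous f) : Continuous (scaleAverage α i f) := by
  have : Continuous fun x => ∫ y in (0 : ℝ)..1, f (x * y) * (((i : ℝ) + 1) * y ^ i) := by
    apply intervalIntegral.continuous_parametric_intervalIntegral_of_continuous'
    simp only [Function.uncurry_def]
    fun_prop
  unfold scaleAverage
  fun_prop

lemma scaleAverage_nonneg (hα : α ∈ Set.Ioo (0 : ℝ) 1) (h0 : ∀ x, 0 ≤ x → 0 ≤ f x) {x : ℝ}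
    (hx : 0 ≤ x) : 0 ≤ scaleAverage α i f x := by
  have h1 : 0 ≤ ∫ y in (0 : ℝ)..1, f (x * y) * (((i : ℝ) + 1) * y ^ i) :=
    intervalIntegral.integral_nonneg zero_le_one fun y hy =>
      mul_nonneg (h0 _ (mul_nonneg hx hy.1)) (mul_nonneg (by positivity) (pow_nonneg hy.1 _))
  have := hα.1.le
  have : 0 ≤ 1 - α := by linarith [hα.2]
  have := h0 x hx
  unfold scaleAverage
  positivity

lemma scaleAverage_antitoneOn (hα : α ∈ Set.Ioo (0 : ℝ) 1) (hf : Continuous f)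
    (ha : AntitoneOn f (Set.Ici 0)) : AntitoneOn (scaleAverage α i f) (Set.Ici 0) := by
  intro x hx x' hx' hxx'
  have h1 : ∫ y in (0 : ℝ)..1, f (x' * y) * (((i : ℝ) + 1) * y ^ i)
      ≤ ∫ y in (0 : ℝ)..1, f (x * y) * (((i : ℝ) + 1) * y ^ i) := by
    refine intervalIntegral.integral_mono_on zero_le_one (intervalIntegrable_scale hf _)
      (intervalIntegrable_scale hf _) fun y hy => ?_
    refine mul_le_mul_of_nonneg_right ?_ (mul_nonneg (by positivity) (pow_nonneg hy.1 _))
    exact ha (mul_nonneg hx hy.1) (mul_nonneg hx' hy.1) (mul_le_mul_of_nonneg_right hxx' hy.1)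
  have := hα.1.le
  have : 0 ≤ 1 - α := by linarith [hα.2]
  have := ha hx hx' hxx'
  unfold scaleAverage
  gcongr

/-- Under the density `(i+1)y^i` the mean of `1/y` is `(i+1)/i`, finite only for `i ≠ 0`; the new
constant is `α + (1-α)(i+1)/i`. -/
lemma scaleAverage_le_div (hα : α ∈ Set.Ioo (0 : ℝ) 1) (hf : Continuous f) (hi : i ≠ 0) {A : ℝ}
    (h : ∀ x, 0 < x → f x ≤ A / x) {x : ℝ} (hx : 0 < x) :
    scaleAverage α i f x ≤ A * ((i + (1 - α)) / i) / x := by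
  obtain ⟨j, rfl⟩ := Nat.exists_eq_succ_of_ne_zero hi
  have h1 : ∫ y in (0 : ℝ)..1, f (x * y) * (((j.succ : ℕ) + 1 : ℝ) * y ^ j.succ)
      ≤ ∫ y in (0 : ℝ)..1, (A / x * (((j.succ : ℕ) + 1 : ℝ))) * y ^ j := by
    refine intervalIntegral.integral_mono_on_of_le_Ioo zero_le_one (intervalIntegrable_scale hf _)
      (Continuous.intervalIntegrable (by fun_prop) _ _) fun y hy => ?_
    have hy0 := hy.1
    calc f (x * y) * (((j.succ : ℕ) + 1 : ℝ) * y ^ j.succ)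
        ≤ A / (x * y) * (((j.succ : ℕ) + 1 : ℝ) * y ^ j.succ) := by
          gcongr; exact h _ (by positivity)
      _ = _ := by rw [pow_succ]; field_simp
  rw [intervalIntegral.integral_const_mul, integral_pow] at h1
  have := hα.1.le
  have : 0 ≤ 1 - α := by linarith [hα.2]
  calc scaleAverage α j.succ f x ≤ α * (A / x) + (1 - α) *
        (A / x * (j.succ + 1) * ((1 ^ (j + 1) - 0 ^ (j + 1)) / (j + 1))) := by
        unfold scaleAverage
        gcongr
        exact h x hx
    _ = _ := by
        push_cast
        simp only [one_pow, ne_eq, Nat.add_eq_zero_iff, one_ne_zero, and_false, not_false_eq_true,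
          zero_pow, sub_zero]
        field_simp
        ring

/-- The new factor is the `k`-th moment `α + (1-α)(i+1)/(k+i+1)` of the averaging law. The geometric
bound on the coefficients justifies termwise integration. -/
lemma hasSum_scaleAverage {a : ℕ → ℝ} {c : ℝ}
    (hac : ∀ k, |a k| ≤ c ^ k)
    (hs : ∀ x, HasSum (fun k => a k * ((-x) ^ k / k.factorial)) (f x)) (x : ℝ) :
    HasSum (fun k : ℕ => a k * ((α * k + (i + 1)) / (k + (i + 1))) * ((-x) ^ k / k.factorial))
      (scaleAverage α i f x) := by
  have h1 : HasSum (fun k => ∫ y in (0 : ℝ)..1,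
      a k * ((-(x * y)) ^ k / k.factorial) * (((i : ℝ) + 1) * y ^ i))
      (∫ y in (0 : ℝ)..1, f (x * y) * (((i : ℝ) + 1) * y ^ i)) := by
    refine intervalIntegral.hasSum_integral_of_dominated_convergence
      (fun k _ => (c * |x|) ^ k / k.factorial * ((i : ℝ) + 1))
      (fun k => Continuous.aestronglyMeasurable (by fun_prop)) (fun k => ae_of_all _ ?_)
      (ae_of_all _ fun y _ => ((Real.summable_pow_div_factorial (c * |x|)).mul_right _))
      (by simp) (ae_of_all _ fun y _ => (hs (x * y)).mul_right _)
    intro y hy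
    rw [Set.uIoc_of_le zero_le_one] at hy
    have hy0 := hy.1.le
    rw [norm_mul, norm_mul, norm_mul, norm_div, norm_pow, norm_pow, norm_neg, norm_mul]
    simp only [Real.norm_eq_abs, Nat.abs_cast, abs_of_nonneg hy0]
    rw [abs_of_nonneg (by positivity : (0 : ℝ) ≤ (i : ℝ) + 1), mul_pow c, mul_div_assoc]
    have : y ^ i ≤ 1 := pow_le_one₀ hy0 hy.2
    have : (|x| * y) ^ k ≤ |x| ^ k := by
      gcongr
      exact mul_le_of_le_one_right (abs_nonneg _) hy.2
    have hc : 0 ≤ c ^ k := (abs_nonneg _).trans (hac k)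
    calc |a k| * ((|x| * y) ^ k / k.factorial) * ((i + 1) * y ^ i)
        ≤ c ^ k * (|x| ^ k / k.factorial) * ((i + 1) * 1) := by gcongr; exact hac k
      _ = _ := by ring
  refine HasSum.congr_fun (((hs x).mul_left α).add (h1.mul_left (1 - α))) fun k => ?_
  have h2 : ∀ y : ℝ, a k * ((-(x * y)) ^ k / k.factorial) * (((i : ℝ) + 1) * y ^ i)
      = (a k * ((-x) ^ k / k.factorial) * ((i : ℝ) + 1)) * y ^ (k + i) := fun y => by
    rw [← neg_mul, mul_pow, pow_add]; ring
  simp only [h2]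
  rw [intervalIntegral.integral_const_mul, integral_pow]
  have : (k : ℝ) + (i + 1) ≠ 0 := by positivity
  have : (k : ℝ) + i + 1 ≠ 0 := by positivity
  push_cast
  simp only [one_pow, ne_eq, Nat.add_eq_zero_iff, one_ne_zero, and_false, not_false_eq_true,
    zero_pow, sub_zero]
  field_simp
  ring

end ScaleAverage

/-- Successive averages of the exponential `x ↦ exp (-(c * x))`. -/
noncomputable def expAverage (α c : ℝ) : ℕ → ℝ → ℝ
  | 0 => fun x => Real.exp (-(c * x))
  | i + 1 => scaleAverage α i (expAverage α c i)

/-! ### Series, positivity, monotonicity and decay of the iterated averages. -/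

section ExpAverage

variable {α c : ℝ}

lemma continuous_expAverage (α c : ℝ) (n : ℕ) : Continuous (expAverage α c n) := by
  induction n with
  | zero => unfold expAverage; fun_prop
  | succ n ih => exact continuous_scaleAverage ih

lemma expAverage_nonneg (hα : α ∈ Set.Ioo (0 : ℝ) 1) (n : ℕ) :
    ∀ x, 0 ≤ x → 0 ≤ expAverage α c n x := by
  induction n with
  | zero => exact fun x _ => (Real.exp_pos _).le
  | succ n ih => exact fun x hx => scaleAverage_nonneg hα ih hx

lemma expAverage_antitoneOn (hα : α ∈ Set.Ioo (0 : ℝ) 1) (hc : 0 ≤ c) (n : ℕ) :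
    AntitoneOn (expAverage α c n) (Set.Ici 0) := by
  induction n with
  | zero =>
    intro x _ y _ hxy
    simp only [expAverage]
    gcongr
  | succ n ih => exact scaleAverage_antitoneOn hα (continuous_expAverage _ _ _) ih

/-- For `i = 0` the mean of `1/y` diverges, so the decay of the first average comes from integrating
the exponential explicitly. -/
lemma expAverage_one_le (hα : α ∈ Set.Ioo (0 : ℝ) 1) (hc : 0 < c) {x : ℝ} (hx : 0 < x) :
    expAverage α c 1 x ≤ 1 / c / x := by
  have hcx : 0 < c * x := by positivity
  have h1 : ∫ y in (0 : ℝ)..1, Real.exp (-(c * (x * y))) * (((0 : ℕ) + 1 : ℝ) * y ^ 0)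
      = (1 - Real.exp (-(c * x))) / (c * x) := by
    have : ∀ y ∈ Set.uIcc (0 : ℝ) 1, HasDerivAt (fun y => -Real.exp (-(c * (x * y))) / (c * x))
        (Real.exp (-(c * (x * y))) * (((0 : ℕ) + 1 : ℝ) * y ^ 0)) y := by
      intro y _
      have h := (((((hasDerivAt_id y).const_mul x).const_mul c).neg).exp.neg).div_const (c * x)
      refine h.congr_deriv ?_
      field_simp
      simp
    rw [intervalIntegral.integral_eq_sub_of_hasDerivAt this
      (Continuous.intervalIntegrable (by fun_prop) _ _)]
    simp only [mul_one, mul_zero, neg_zero, Real.exp_zero]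
    ring
  have h2 : Real.exp (-(c * x)) ≤ 1 / (c * x) := by
    rw [Real.exp_neg, one_div]
    gcongr
    linarith [Real.add_one_le_exp (c * x)]
  have h3 : (1 - Real.exp (-(c * x))) / (c * x) ≤ 1 / (c * x) := by
    gcongr
    linarith [Real.exp_pos (-(c * x))]
  have h4 : expAverage α c 1 x
      = α * Real.exp (-(c * x)) + (1 - α) * ((1 - Real.exp (-(c * x))) / (c * x)) := by
    rw [← h1]; rfl
  rw [h4, div_div]
  have := hα.1.le
  have : 0 ≤ 1 - α := by linarith [hα.2]
  calc _ ≤ α * (1 / (c * x)) + (1 - α) * (1 / (c * x)) := by gcongr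
    _ = _ := by ring

lemma expAverage_le_div (hα : α ∈ Set.Ioo (0 : ℝ) 1) (hc : 0 < c) (n : ℕ) :
    ∀ x, 0 < x → expAverage α c (n + 1) x
      ≤ (1 / c * ∏ j ∈ Finset.range n, ((j : ℝ) + 1 + (1 - α)) / ((j : ℝ) + 1)) / x := by
  induction n with
  | zero => simpa using fun x hx => expAverage_one_le hα hc (x := x) hx
  | succ n ih =>
    intro x hx
    have := scaleAverage_le_div hα (continuous_expAverage α c (n + 1)) n.succ_ne_zero ih hx
    rw [Finset.prod_range_succ, ← mul_assoc]
    exact_mod_cast this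

/-- Each factor is at most `exp(b/(j+1))`, and the harmonic sum is at most `1 + log(n+1)`; the
constant `e` uses `b ≤ 1`. -/
lemma prod_add_div_le {b : ℝ} (hb0 : 0 ≤ b) (hb1 : b ≤ 1) (n : ℕ) :
    ∏ j ∈ Finset.range n, ((j : ℝ) + 1 + b) / ((j : ℝ) + 1)
      ≤ Real.exp 1 * ((n : ℝ) + 1) ^ b := by
  have h1 : ∏ j ∈ Finset.range n, ((j : ℝ) + 1 + b) / ((j : ℝ) + 1)
      ≤ ∏ j ∈ Finset.range n, Real.exp (b * ((j : ℝ) + 1)⁻¹) := by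
    refine Finset.prod_le_prod (fun j _ => by positivity) fun j _ => ?_
    have h := Real.add_one_le_exp (b * ((j : ℝ) + 1)⁻¹)
    have : ((j : ℝ) + 1 + b) / ((j : ℝ) + 1) = b * ((j : ℝ) + 1)⁻¹ + 1 := by
      field_simp; ring
    linarith
  have h2 : ∑ j ∈ Finset.range n, ((j : ℝ) + 1)⁻¹ ≤ 1 + Real.log (n + 1) := by
    have h := harmonic_le_one_add_log n
    have h' : ((harmonic n : ℚ) : ℝ) = ∑ j ∈ Finset.range n, ((j : ℝ) + 1)⁻¹ := by
      simp [harmonic]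
    rw [h'] at h
    rcases Nat.eq_zero_or_pos n with rfl | hn
    · simp
    · refine h.trans ?_
      have : (0 : ℝ) < n := by exact_mod_cast hn
      gcongr
      linarith
  have hn : (0 : ℝ) < n + 1 := by positivity
  rw [← Real.exp_sum, ← Finset.mul_sum] at h1
  refine h1.trans ?_
  rw [Real.rpow_def_of_pos hn, ← Real.exp_add]
  gcongr
  nlinarith

lemma hasSum_expAverage (hα : α ∈ Set.Ioo (0 : ℝ) 1) (n : ℕ) (hc : 0 ≤ c) :
    ∀ x, HasSum (fun k : ℕ => (c ^ k * ∏ i ∈ Finset.range n, (α * k + (i + 1)) / (k + (i + 1))) *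
      ((-x) ^ k / k.factorial)) (expAverage α c n x) := by
  have hα0 := hα.1.le
  induction n with
  | zero =>
    intro x
    have h := NormedSpace.expSeries_div_hasSum_exp (-(c * x))
    rw [← Real.exp_eq_exp_ℝ] at h
    refine h.congr_fun fun k => ?_
    rw [← mul_neg, mul_pow]
    simp [mul_div_assoc]
  | succ n ih =>
    intro x
    have h := hasSum_scaleAverage (α := α) (i := n) (c := c)
      (fun k => ?_) ih x
    · refine h.congr_fun fun k => ?_
      rw [Finset.prod_range_succ]; ring
    · rw [abs_of_nonneg (by positivity)]
      refine mul_le_of_le_one_right (by positivity) (Finset.prod_le_one (fun i _ => by positivity)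
        fun i _ => ?_)
      rw [div_le_one (by positivity)]
      gcongr
      exact mul_le_of_le_one_left (by positivity) hα.2.le

end ExpAverage

/-! ### Passage from averaged exponentials to the Mittag-Leffler function. -/

section Limit

variable {α : ℝ}

/-- Quotient of Euler's products for `Γ(k)` and `Γ(kα)`; the prefactors `k` and `kα` shift the
arguments by one and cancel the `j = 0` factors of the products. -/
lemma tendsto_gammaRatio (hα : α ∈ Set.Ioo (0 : ℝ) 1) (k : ℕ) :
    Tendsto (fun n : ℕ => (((n : ℝ) ^ (1 - α)) ^ k *
      ∏ i ∈ Finset.range n, (α * k + (i + 1)) / (k + (i + 1)))) atTop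
      (𝓝 (k.factorial / Real.Gamma (k * α + 1))) := by
  have hα0 := hα.1
  rcases Nat.eq_zero_or_pos k with rfl | hk
  · have : ∀ n : ℕ, ∏ i ∈ Finset.range n, ((i : ℝ) + 1) / (i + 1) = 1 := fun n =>
      Finset.prod_eq_one fun i _ => div_self (by positivity)
    simp [this]
  have hk' : (0 : ℝ) < k := by exact_mod_cast hk
  have h1 := ((Real.GammaSeq_tendsto_Gamma (k : ℝ)).const_mul (k : ℝ)).div
    ((Real.GammaSeq_tendsto_Gamma (k * α)).const_mul (k * α))
    (mul_pos (by positivity) (Real.Gamma_pos_of_pos (by positivity))).ne'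
  rw [← Real.Gamma_add_one (by positivity), ← Real.Gamma_add_one (by positivity),
    Real.Gamma_nat_eq_factorial] at h1
  refine h1.congr' ?_
  filter_upwards [eventually_gt_atTop 0] with n hn
  have hn' : (0 : ℝ) < n := by exact_mod_cast hn
  have hf : (0 : ℝ) < n.factorial := by exact_mod_cast n.factorial_pos
  simp only [Pi.div_apply, Real.GammaSeq]
  rw [Finset.prod_range_succ', Finset.prod_range_succ', Finset.prod_div_distrib]
  have e1 : ((n : ℝ) ^ (1 - α)) ^ k = (n : ℝ) ^ (k : ℝ) / (n : ℝ) ^ (k * α) := by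
    rw [← Real.rpow_natCast, ← Real.rpow_mul hn'.le, ← Real.rpow_sub hn']
    ring_nf
  rw [e1]
  have p1 : (0 : ℝ) < (n : ℝ) ^ (k * α) := by positivity
  have p2 : 0 < ∏ i ∈ Finset.range n, ((k : ℝ) * α + ((i + 1 : ℕ) : ℝ)) :=
    Finset.prod_pos fun i _ => by positivity
  have p3 : 0 < ∏ i ∈ Finset.range n, ((k : ℝ) + ((i + 1 : ℕ) : ℝ)) :=
    Finset.prod_pos fun i _ => by positivity
  push_cast at p2 p3 ⊢
  rw [mul_comm α]
  field_simp
  simp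

/-- A majorant independent of `n`. With `n` enlarged to `y = k+n+1` the expression is nonincreasing
in `n`: a step multiplies it by `(1+1/y)^{(1-α)k} (1-(1-α)k/y) ≤ e^u e^{-u}`, where `u = (1-α)k/y`.
The bound is its value at `n = 0`. -/
lemma gammaRatio_le (hα : α ∈ Set.Ioo (0 : ℝ) 1) (k n : ℕ) :
    ((n : ℝ) ^ (1 - α)) ^ k * ∏ i ∈ Finset.range n, (α * k + (i + 1)) / (k + (i + 1))
      ≤ (((k : ℝ) + 1) ^ (1 - α)) ^ k := by
  have hα0 := hα.1.le
  have hb : 0 ≤ 1 - α := by linarith [hα.2]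
  have key : ∀ n : ℕ, (((k : ℝ) + n + 1) ^ (1 - α)) ^ k *
      ∏ i ∈ Finset.range n, (α * k + (i + 1)) / (k + (i + 1)) ≤ (((k : ℝ) + 1) ^ (1 - α)) ^ k := by
    intro n
    induction n with
    | zero => simp
    | succ n ih =>
      refine le_trans ?_ ih
      rw [Finset.prod_range_succ, mul_comm (∏ i ∈ Finset.range n, _), ← mul_assoc]
      refine mul_le_mul_of_nonneg_right ?_ (Finset.prod_nonneg fun i _ => by positivity)
      have hy : (0 : ℝ) < k + n + 1 := by positivity
      set y : ℝ := k + n + 1 with hy'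
      have e1 : (k : ℝ) + (n + 1 : ℕ) + 1 = y * (1 + y⁻¹) := by
        push_cast; field_simp; rw [hy']; ring
      have e2 : (α * k + (n + 1)) / ((k : ℝ) + (n + 1)) = -((1 - α) * k * y⁻¹) + 1 := by
        rw [show (k : ℝ) + (n + 1) = y by rw [hy']; ring]
        field_simp; rw [hy']; ring
      rw [e1, e2, Real.mul_rpow hy.le (by positivity), mul_pow, mul_assoc]
      refine mul_le_of_le_one_right (by positivity) ?_
      have h1 : ((1 + y⁻¹) ^ (1 - α)) ^ k ≤ Real.exp ((1 - α) * k * y⁻¹) := by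
        rw [← Real.rpow_natCast, ← Real.rpow_mul (by positivity), mul_comm _ y⁻¹, Real.exp_mul]
        gcongr
        linarith [Real.add_one_le_exp y⁻¹]
      calc _ ≤ Real.exp ((1 - α) * k * y⁻¹) * Real.exp (-((1 - α) * k * y⁻¹)) := by
            refine mul_le_mul h1 (Real.add_one_le_exp _) ?_ (Real.exp_pos _).le
            rw [← e2]; positivity
        _ = 1 := by rw [← Real.exp_add]; simp
  refine le_trans ?_ (key n)
  have : 0 ≤ ∏ i ∈ Finset.range n, (α * k + (i + 1)) / ((k : ℝ) + (i + 1)) :=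
    Finset.prod_nonneg fun i _ => by positivity
  have : (0 : ℝ) ≤ k := by positivity
  gcongr
  linarith

/-- Since `(k+1)^k/k! ≤ e^{k+1}`, the term is at most `e (x e (k+1)^{-α})^k`, whose base tends to
`0`. -/
lemma summable_gammaRatio_bound (hα : α ∈ Set.Ioo (0 : ℝ) 1) {x : ℝ} (hx : 0 ≤ x) :
    Summable fun k : ℕ => (((k : ℝ) + 1) ^ (1 - α)) ^ k * (x ^ k / k.factorial) := by
  have h0 : Tendsto (fun k : ℕ => x * Real.exp 1 * ((k : ℝ) + 1) ^ (-α)) atTop (𝓝 0) := by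
    have h := ((tendsto_rpow_neg_atTop hα.1).comp
      (tendsto_atTop_add_const_right atTop (1 : ℝ) tendsto_natCast_atTop_atTop)).const_mul
      (x * Real.exp 1)
    simpa [Function.comp_def] using h
  have h1 : ∀ᶠ k : ℕ in atTop, x * Real.exp 1 * ((k : ℝ) + 1) ^ (-α) ≤ 1 / 2 :=
    h0.eventually_le_const (by norm_num)
  refine Summable.of_norm_bounded_eventually_nat (g := fun k => Real.exp 1 * (1 / 2 : ℝ) ^ k)
    (summable_geometric_two.mul_left _) ?_
  filter_upwards [h1] with k hk
  have hk1 : (0 : ℝ) < k + 1 := by positivity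
  rw [Real.norm_of_nonneg (by positivity)]
  have h2 := Real.pow_div_factorial_le_exp (x := (k : ℝ) + 1) hk1.le k
  calc (((k : ℝ) + 1) ^ (1 - α)) ^ k * (x ^ k / k.factorial)
      = (x * ((k : ℝ) + 1) ^ (-α)) ^ k * (((k : ℝ) + 1) ^ k / k.factorial) := by
        rw [sub_eq_add_neg, Real.rpow_add hk1, Real.rpow_one, mul_pow, mul_pow]; ring
    _ ≤ (x * ((k : ℝ) + 1) ^ (-α)) ^ k * Real.exp (k + 1) := by gcongr
    _ = Real.exp 1 * (x * Real.exp 1 * ((k : ℝ) + 1) ^ (-α)) ^ k := by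
        rw [Real.exp_add, ← Real.exp_one_pow k, mul_pow, mul_pow, mul_pow]; ring
    _ ≤ _ := by gcongr

lemma tendsto_expAverage (hα : α ∈ Set.Ioo (0 : ℝ) 1) {x : ℝ} (hx : 0 ≤ x) :
    Tendsto (fun n : ℕ => expAverage α ((n : ℝ) ^ (1 - α)) n x) atTop
      (𝓝 (mittagLeffler α 1 (-x))) := by
  have hα0 := hα.1.le
  have h : ∀ n : ℕ, expAverage α ((n : ℝ) ^ (1 - α)) n x = ∑' k : ℕ, (((n : ℝ) ^ (1 - α)) ^ k *
      ∏ i ∈ Finset.range n, (α * k + (i + 1)) / (k + (i + 1))) * ((-x) ^ k / k.factorial) :=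
    fun n => (hasSum_expAverage hα n (by positivity) x).tsum_eq.symm
  simp only [h, mittagLeffler]
  refine tendsto_tsum_of_dominated_convergence (summable_gammaRatio_bound hα hx) (fun k => ?_)
    (Eventually.of_forall fun n k => ?_)
  · have hf : (0 : ℝ) < k.factorial := by exact_mod_cast k.factorial_pos
    convert (tendsto_gammaRatio hα k).mul_const ((-x) ^ k / k.factorial) using 2
    field_simp
  · rw [norm_mul, norm_div, norm_pow, norm_neg, Real.norm_of_nonneg hx, Real.norm_natCast,
      Real.norm_of_nonneg (by positivity)]
    gcongr
    exact gammaRatio_le hα k n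

theorem mittagLeffler_neg_nonneg (hα : α ∈ Set.Ioo (0 : ℝ) 1) {x : ℝ} (hx : 0 ≤ x) :
    0 ≤ mittagLeffler α 1 (-x) :=
  ge_of_tendsto' (tendsto_expAverage hα hx) fun n => expAverage_nonneg hα n x hx

theorem mittagLeffler_neg_antitoneOn (hα : α ∈ Set.Ioo (0 : ℝ) 1) :
    AntitoneOn (fun x => mittagLeffler α 1 (-x)) (Set.Ici 0) := fun _ hx _ hy hxy =>
  le_of_tendsto_of_tendsto' (tendsto_expAverage hα hy) (tendsto_expAverage hα hx) fun n =>
    expAverage_antitoneOn hα (by positivity) n hx hy hxy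

lemma mittagLeffler_zero (α : ℝ) : mittagLeffler α 1 0 = 1 := by
  rw [mittagLeffler, tsum_eq_single 0 fun k hk => by simp [hk]]
  simp

theorem mittagLeffler_neg_le_one (hα : α ∈ Set.Ioo (0 : ℝ) 1) {x : ℝ} (hx : 0 ≤ x) :
    mittagLeffler α 1 (-x) ≤ 1 := by
  simpa [mittagLeffler_zero] using
    mittagLeffler_neg_antitoneOn hα (Set.self_mem_Ici) (Set.mem_Ici.2 hx) hx

theorem mittagLeffler_neg_le_div (hα : α ∈ Set.Ioo (0 : ℝ) 1) {x : ℝ} (hx : 0 < x) :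
    mittagLeffler α 1 (-x) ≤ Real.exp 1 / x := by
  refine le_of_tendsto (tendsto_expAverage hα hx.le) ?_
  -- Decay starts with the first average, so `n = m+1`; then `c = (m+1)^{1-α}` cancels the growth of
  -- the product and leaves `e`.
  filter_upwards [eventually_gt_atTop 0] with n hn
  obtain ⟨m, rfl⟩ := Nat.exists_eq_succ_of_ne_zero hn.ne'
  have hm : (0 : ℝ) < ((m.succ : ℕ) : ℝ) ^ (1 - α) := by positivity
  refine (expAverage_le_div hα hm m x hx).trans ?_
  gcongr
  have h := prod_add_div_le (by linarith [hα.2] : 0 ≤ 1 - α) (by linarith [hα.1]) m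
  calc _ ≤ 1 / ((m.succ : ℕ) : ℝ) ^ (1 - α) * (Real.exp 1 * ((m : ℝ) + 1) ^ (1 - α)) := by gcongr
    _ = Real.exp 1 := by
      push_cast at hm ⊢
      field_simp

/-- The bounds `E_{α,1}(-x) ≤ 1` and `E_{α,1}(-x) ≤ e / x`, interpolated. -/
theorem mittagLeffler_neg_le_rpow (hα : α ∈ Set.Ioo (0 : ℝ) 1) {x σ : ℝ} (hx : 0 < x)
    (hσ : σ ∈ Set.Icc (0 : ℝ) 1) : mittagLeffler α 1 (-x) ≤ Real.exp 1 * x ^ (-σ) := by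
  have he : 1 ≤ Real.exp 1 := by linarith [Real.add_one_le_exp (1 : ℝ)]
  rcases le_total x 1 with h1 | h1
  · refine (mittagLeffler_neg_le_one hα hx.le).trans ?_
    have := Real.one_le_rpow_of_pos_of_le_one_of_nonpos hx h1 (neg_nonpos.2 hσ.1)
    nlinarith
  · refine (mittagLeffler_neg_le_div hα hx).trans ?_
    rw [div_eq_mul_inv, ← Real.rpow_neg_one]
    gcongr
    exact hσ.2

end Limit

/-! ### Wiener integrals with respect to a fractional Brownian curve in a Hilbert space -/

section HilbertCurve

variable {E : Type*} [NormedAddCommGroup E] [InnerProductSpace ℝ E]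

/-- A curve in a Hilbert space with the covariance of fractional Brownian motion. -/
def IsFBMCurve (H : ℝ) (w : ℝ≥0 → E) : Prop :=
  ∀ a b : ℝ≥0, inner ℝ (w a) (w b) =
    ((a : ℝ) ^ (2 * H) + (b : ℝ) ^ (2 * H) - |(a : ℝ) - b| ^ (2 * H)) / 2

variable {H : ℝ} {w : ℝ≥0 → E}

/-- Existence and the norm bound use the covariance only through this identity; the full covariance
is needed for uniqueness. -/
lemma IsFBMCurve.norm_sub (hw : IsFBMCurve H w) (hH : 0 < H) (a b : ℝ≥0) :
    ‖w a - w b‖ = |(a : ℝ) - b| ^ H := by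
  have h2 : 2 * H ≠ 0 := by positivity
  have h : ‖w a - w b‖ ^ 2 = (|(a : ℝ) - b| ^ H) ^ 2 := by
    rw [norm_sub_sq_real, ← real_inner_self_eq_norm_sq, ← real_inner_self_eq_norm_sq, hw, hw, hw,
      ← Real.rpow_mul_natCast (abs_nonneg _)]
    simp only [sub_self, abs_zero, Real.zero_rpow h2, Nat.cast_ofNat, mul_comm H 2]
    ring
  exact (pow_left_inj₀ (norm_nonneg _) (by positivity) two_ne_zero).1 h

lemma IsFBMCurve.map_zero (hw : IsFBMCurve H w) (hH : 0 < H) : w 0 = 0 := by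
  have h2 : 2 * H ≠ 0 := by positivity
  have h := hw 0 0
  simp only [NNReal.coe_zero, Real.zero_rpow h2, sub_self, abs_zero, add_zero, zero_div] at h
  exact inner_self_eq_zero.1 h

lemma IsFBMCurve.continuous (hw : IsFBMCurve H w) (hH : 0 < H) : Continuous w := by
  rw [continuous_iff_continuousAt]
  intro b
  rw [ContinuousAt, tendsto_iff_norm_sub_tendsto_zero]
  simp only [hw.norm_sub hH]
  have h : Continuous fun a : ℝ≥0 => |(a : ℝ) - b| ^ H :=
    Continuous.rpow_const (by fun_prop) fun _ => Or.inr hH.le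
  simpa [Real.zero_rpow hH.ne'] using h.tendsto b

lemma stepFun_eq_linearCombination (c : ℝ≥0 →₀ ℝ) (r : ℝ) :
    stepFun c r = Finsupp.linearCombination ℝ
      (fun a : ℝ≥0 => (Set.Ioc (0 : ℝ) a).indicator (1 : ℝ → ℝ) r) c := rfl

lemma stepFun_sub (c d : ℝ≥0 →₀ ℝ) (r : ℝ) : stepFun (c - d) r = stepFun c r - stepFun d r := by
  simp only [stepFun_eq_linearCombination, map_sub]

lemma measurable_stepFun (c : ℝ≥0 →₀ ℝ) : Measurable (stepFun c) := by
  unfold stepFun Finsupp.sum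
  refine Finset.measurable_fun_sum _ fun a _ => ?_
  exact measurable_const.mul (measurable_one.indicator measurableSet_Ioc)

/-- The integral of a step function against a continuous function. -/
lemma integral_stepFun_mul {t : ℝ≥0} {c : ℝ≥0 →₀ ℝ} (hc : ∀ a ∈ c.support, a ≤ t) {z : ℝ → ℝ}
    (hz : Continuous z) : ∫ r in Set.Ioc (0 : ℝ) t, stepFun c r * z r =
      Finsupp.linearCombination ℝ (fun a : ℝ≥0 => ∫ r in (0 : ℝ)..a, z r) c := by
  have h1 : ∀ r, stepFun c r * z r =
      ∑ a ∈ c.support, c a * (Set.Ioc (0 : ℝ) a).indicator z r := by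
    intro r
    rw [stepFun, Finsupp.sum, Finset.sum_mul]
    refine Finset.sum_congr rfl fun a _ => ?_
    by_cases hr : r ∈ Set.Ioc (0 : ℝ) a <;> simp [hr]
  have hzi : ∀ a : ℝ≥0, IntegrableOn z (Set.Ioc (0 : ℝ) a) := fun a =>
    (hz.integrableOn_Icc).mono_set Set.Ioc_subset_Icc_self
  simp only [h1]
  rw [integral_finsetSum _ fun a _ =>
    (((hzi t).indicator measurableSet_Ioc).const_mul (c a)), Finsupp.linearCombination_apply,
    Finsupp.sum]
  refine Finset.sum_congr rfl fun a ha => ?_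
  rw [integral_const_mul, smul_eq_mul, setIntegral_indicator measurableSet_Ioc,
    Set.Ioc_inter_Ioc, intervalIntegral.integral_of_le a.coe_nonneg]
  have : (a : ℝ) ≤ t := hc a ha
  simp [this]

/-- The antiderivative of `|x| ^ p` vanishing at `0`. -/
noncomputable def absRpowPrimitive (p y : ℝ) : ℝ := ∫ x in (0 : ℝ)..y, |x| ^ p

lemma continuous_abs_rpow {p : ℝ} (hp : 0 ≤ p) : Continuous fun x : ℝ => |x| ^ p :=
  Continuous.rpow_const (by fun_prop) fun _ => Or.inr hp

lemma hasDerivAt_absRpowPrimitive {p : ℝ} (hp : 0 ≤ p) (y : ℝ) :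
    HasDerivAt (absRpowPrimitive p) (|y| ^ p) y :=
  intervalIntegral.integral_hasDerivAt_right ((continuous_abs_rpow hp).intervalIntegrable _ _)
    (continuous_abs_rpow hp).stronglyMeasurable.stronglyMeasurableAtFilter
    (continuous_abs_rpow hp).continuousAt

lemma integral_abs_sub_rpow {p : ℝ} (hp : 0 ≤ p) (a x y : ℝ) :
    ∫ u in x..y, |a - u| ^ p = absRpowPrimitive p (y - a) - absRpowPrimitive p (x - a) := by
  have h := intervalIntegral.integral_comp_sub_right (a := x) (b := y) (fun u : ℝ => |u| ^ p) a
  simp only [abs_sub_comm a]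
  rw [h, absRpowPrimitive, absRpowPrimitive, intervalIntegral.integral_interval_sub_left] <;>
    exact (continuous_abs_rpow hp).intervalIntegrable _ _

/-- The covariance of `w a` with the difference of the means of `w` over `[b, b + δ]` and `[0, δ]`
is the primitive of a continuous function of `a`. -/
lemma IsFBMCurve.inner_integral_sub (hw : IsFBMCurve H w) (hH : 0 < H) (a : ℝ≥0) {b δ : ℝ}
    (hb : 0 ≤ b) (hδ : 0 ≤ δ) :
    (∫ u in b..b + δ, inner ℝ (w a) (w u.toNNReal)) - ∫ u in 0..δ, inner ℝ (w a) (w u.toNNReal) =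
      ∫ r in (0 : ℝ)..a, (|b + δ - r| ^ (2 * H) - |b - r| ^ (2 * H) - |δ - r| ^ (2 * H)
        + |0 - r| ^ (2 * H)) / 2 := by
  have hp : 0 ≤ 2 * H := by positivity
  have cont := continuous_abs_rpow hp
  -- Both intervals have length `δ`, so the terms in `a^{2H}` cancel in the difference. Their
  -- derivative in `a` would be singular at `0` for `H < 1/2`.
  have hi : ∀ x y : ℝ, 0 ≤ x → x ≤ y → ∫ u in x..y, inner ℝ (w a) (w u.toNNReal) =
      ((y - x) * (a : ℝ) ^ (2 * H) + (absRpowPrimitive (2 * H) y - absRpowPrimitive (2 * H) x)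
        - (absRpowPrimitive (2 * H) (y - a) - absRpowPrimitive (2 * H) (x - a))) / 2 := by
    intro x y hx hxy
    have h0 := integral_abs_sub_rpow hp 0 x y
    simp only [zero_sub, abs_neg, sub_zero] at h0
    rw [← h0, ← integral_abs_sub_rpow hp a x y, ← smul_eq_mul, ← intervalIntegral.integral_const,
      ← intervalIntegral.integral_add (by simp) (cont.intervalIntegrable _ _),
      ← intervalIntegral.integral_sub, ← intervalIntegral.integral_div]
    · refine intervalIntegral.integral_congr fun u hu => ?_
      rw [Set.uIcc_of_le hxy] at hu
      have hu0 : 0 ≤ u := hx.trans hu.1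
      simp only [hw a, Real.coe_toNNReal _ hu0, abs_of_nonneg hu0]
    · exact (continuous_const.add cont).intervalIntegrable _ _
    · exact (cont.comp (continuous_const.sub continuous_id)).intervalIntegrable _ _
  have hd : ∀ r ∈ Set.uIcc (0 : ℝ) a, HasDerivAt (fun r => (-(absRpowPrimitive (2 * H) (b + δ - r)
      - absRpowPrimitive (2 * H) (b - r) - absRpowPrimitive (2 * H) (δ - r)
      + absRpowPrimitive (2 * H) (0 - r))) / 2)
      ((|b + δ - r| ^ (2 * H) - |b - r| ^ (2 * H) - |δ - r| ^ (2 * H)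
        + |0 - r| ^ (2 * H)) / 2) r := by
    intro r _
    have hs : ∀ y : ℝ, HasDerivAt (fun r => absRpowPrimitive (2 * H) (y - r))
        (-|y - r| ^ (2 * H)) r := fun y => by
      have := (hasDerivAt_absRpowPrimitive hp (y - r)).comp_const_sub y r
      exact this
    refine (((((hs (b + δ)).sub (hs b)).sub (hs δ)).add (hs 0)).neg.div_const 2).congr_deriv ?_
    ring
  have hc : Continuous fun r : ℝ => (|b + δ - r| ^ (2 * H) - |b - r| ^ (2 * H)
      - |δ - r| ^ (2 * H) + |0 - r| ^ (2 * H)) / 2 := by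
    have hs : ∀ y : ℝ, Continuous fun r : ℝ => |y - r| ^ (2 * H) := fun y =>
      cont.comp (continuous_const.sub continuous_id)
    exact ((((hs _).sub (hs _)).sub (hs _)).add (hs _)).div_const 2
  rw [intervalIntegral.integral_eq_sub_of_hasDerivAt hd (hc.intervalIntegrable _ _),
    hi b (b + δ) hb (by linarith), hi 0 δ le_rfl hδ]
  have h00 : absRpowPrimitive (2 * H) 0 = 0 := by simp [absRpowPrimitive]
  simp only [sub_zero, h00]
  ring

/-- Integrals of step functions that are small in `L²` against a continuous function. -/
lemma tendsto_integral_stepFun_mul {t : ℝ≥0} {c : ℕ → ℝ≥0 →₀ ℝ} {z : ℝ → ℝ} (hz : Continuous z)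
    (h0 : Tendsto (fun m => eLpNorm (stepFun (c m)) 2 (volume.restrict (Set.Ioc (0 : ℝ) t)))
      atTop (𝓝 0)) :
    Tendsto (fun m => ∫ r in Set.Ioc (0 : ℝ) t, stepFun (c m) r * z r) atTop (𝓝 0) := by
  have hzL : MemLp z 2 (volume.restrict (Set.Ioc (0 : ℝ) t)) := by
    obtain ⟨C, hC⟩ := (isCompact_Icc (a := (0 : ℝ)) (b := t)).exists_bound_of_continuousOn
      hz.continuousOn
    refine MemLp.of_bound hz.aestronglyMeasurable C ?_
    filter_upwards [ae_restrict_mem measurableSet_Ioc] with r hr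
    exact hC r (Set.Ioc_subset_Icc_self hr)
  have hb : ∀ m, ‖∫ r in Set.Ioc (0 : ℝ) t, stepFun (c m) r * z r‖ₑ ≤
      eLpNorm (stepFun (c m)) 2 (volume.restrict (Set.Ioc (0 : ℝ) t)) *
        eLpNorm z 2 (volume.restrict (Set.Ioc (0 : ℝ) t)) := by
    intro m
    refine (enorm_integral_le_lintegral_enorm _).trans ?_
    rw [← eLpNorm_one_eq_lintegral_enorm]
    have h : eLpNorm (stepFun (c m) • z) 1 (volume.restrict (Set.Ioc (0 : ℝ) t)) ≤ _ :=
      eLpNorm_smul_le_mul_eLpNorm (p := 2) (q := 2) hzL.1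
        (measurable_stepFun (c m)).aestronglyMeasurable
    exact h
  have hlim := ENNReal.Tendsto.mul_const (b := eLpNorm z 2 (volume.restrict (Set.Ioc (0 : ℝ) t)))
    h0 (Or.inr hzL.2.ne)
  rw [zero_mul] at hlim
  rw [tendsto_zero_iff_norm_tendsto_zero]
  have h1 := tendsto_of_tendsto_of_tendsto_of_le_of_le tendsto_const_nhds hlim
    (fun _ => zero_le) hb
  have h2 := (ENNReal.tendsto_toReal ENNReal.zero_ne_top).comp h1
  simpa [Function.comp_def] using h2

variable [CompleteSpace E]

/-- The integral of step functions with respect to a fractional Brownian curve is closable. -/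
theorem IsFBMCurve.closable (hw : IsFBMCurve H w) (hH : 0 < H) {t : ℝ≥0} {c : ℕ → ℝ≥0 →₀ ℝ}
    (hc : ∀ m, ∀ a ∈ (c m).support, a ≤ t)
    (h0 : Tendsto (fun m => eLpNorm (stepFun (c m)) 2 (volume.restrict (Set.Ioc (0 : ℝ) t)))
      atTop (𝓝 0)) {J : E}
    (hJ : Tendsto (fun m => Finsupp.linearCombination ℝ w (c m)) atTop (𝓝 J)) : J = 0 := by
  have hp : 0 ≤ 2 * H := by positivity
  have cw : Continuous fun u : ℝ => w u.toNNReal :=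
    (hw.continuous hH).comp continuous_real_toNNReal
  have cK : Continuous fun u : ℝ => inner ℝ J (w u.toNNReal) := continuous_const.inner cw
  -- Pairing a step integral with the vector `V` below is integration of the step function against a
  -- continuous `z`, hence is controlled by the `L²` norm and vanishes in the limit.
  have hshift : ∀ b δ : ℝ, 0 ≤ b → 0 ≤ δ →
      (∫ u in b..b + δ, inner ℝ J (w u.toNNReal)) - ∫ u in 0..δ, inner ℝ J (w u.toNNReal) = 0 := by
    intro b δ hb hδ
    set V : E := (∫ u in b..b + δ, w u.toNNReal) - ∫ u in 0..δ, w u.toNNReal with hV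
    have hin : ∀ x : E, inner ℝ x V = (∫ u in b..b + δ, inner ℝ x (w u.toNNReal))
        - ∫ u in 0..δ, inner ℝ x (w u.toNNReal) := by
      intro x
      have h : ∀ y y' : ℝ, ∫ u in y..y', inner ℝ x (w u.toNNReal)
          = inner ℝ x (∫ u in y..y', w u.toNNReal) := fun y y' =>
        (innerSL ℝ x).intervalIntegral_comp_comm (cw.intervalIntegrable y y')
      rw [h, h, hV, inner_sub_right]
    rw [← hin]
    set z : ℝ → ℝ := fun r => (|b + δ - r| ^ (2 * H) - |b - r| ^ (2 * H) - |δ - r| ^ (2 * H)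
        + |0 - r| ^ (2 * H)) / 2 with hz
    have hzc : Continuous z := by
      have hs : ∀ y : ℝ, Continuous fun r : ℝ => |y - r| ^ (2 * H) := fun y =>
        (continuous_abs_rpow hp).comp (continuous_const.sub continuous_id)
      exact ((((hs _).sub (hs _)).sub (hs _)).add (hs _)).div_const 2
    have h1 : ∀ m, inner ℝ (Finsupp.linearCombination ℝ w (c m)) V
        = ∫ r in Set.Ioc (0 : ℝ) t, stepFun (c m) r * z r := by
      intro m
      rw [integral_stepFun_mul (hc m) hzc, Finsupp.linearCombination_apply,
        Finsupp.linearCombination_apply, Finsupp.sum, Finsupp.sum, sum_inner]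
      refine Finset.sum_congr rfl fun a _ => ?_
      rw [real_inner_smul_left, hin, hw.inner_integral_sub hH a hb hδ, smul_eq_mul]
    have h2 := hJ.inner (𝕜 := ℝ) (tendsto_const_nhds (x := V))
    simp only [h1] at h2
    exact tendsto_nhds_unique h2 (tendsto_integral_stepFun_mul hzc h0)
  -- Right derivative of `hshift` at `δ = 0`: the pairing of `J` with `w b` equals that with `w 0 =
  -- 0`.
  have hK0 : ∀ b : ℝ≥0, inner ℝ J (w b) = 0 := by
    intro b
    have hd1 : HasDerivWithinAt (fun δ : ℝ => ∫ u in (b : ℝ)..b + δ, inner ℝ J (w u.toNNReal))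
        (inner ℝ J (w (b : ℝ).toNNReal)) (Set.Ici 0) 0 := by
      have h := (cK.integral_hasStrictDerivAt (b : ℝ) (b + 0)).hasDerivAt.comp_const_add (b : ℝ) 0
      simp only [add_zero] at h
      exact h.hasDerivWithinAt
    have hd2 : HasDerivWithinAt (fun δ : ℝ => ∫ u in (0 : ℝ)..δ, inner ℝ J (w u.toNNReal))
        (inner ℝ J (w (0 : ℝ).toNNReal)) (Set.Ici 0) 0 :=
      (cK.integral_hasStrictDerivAt 0 0).hasDerivAt.hasDerivWithinAt
    have hd3 := hd1.congr (f₁ := fun δ : ℝ => ∫ u in (0 : ℝ)..δ, inner ℝ J (w u.toNNReal))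
      (fun δ hδ => (sub_eq_zero.1 (hshift b δ b.2 hδ)).symm)
      (sub_eq_zero.1 (hshift b 0 b.2 le_rfl)).symm
    have h := (uniqueDiffWithinAt_Ici (0 : ℝ)).eq_deriv _ hd3 hd2
    simpa [hw.map_zero hH] using h
  -- Thus `J` is orthogonal to all step integrals while being a limit of them.
  have h1 : ∀ m, inner ℝ J (Finsupp.linearCombination ℝ w (c m)) = 0 := by
    intro m
    rw [Finsupp.linearCombination_apply, Finsupp.sum, inner_sum]
    exact Finset.sum_eq_zero fun a _ => by rw [real_inner_smul_right, hK0, mul_zero]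
  have h2 := (tendsto_const_nhds (x := J)).inner hJ (𝕜 := ℝ)
  simp only [h1] at h2
  exact inner_self_eq_zero.1 (tendsto_nhds_unique h2 tendsto_const_nhds)

end HilbertCurve

/-! ### Integrals of monotone functions along uniform partitions. -/

section MonotoneIntegrand

/-- The points of the uniform partition of `[0, t]` into `N` intervals. -/
noncomputable def gridPoint (t : ℝ≥0) (N i : ℕ) : ℝ≥0 := t * (i / N)

lemma coe_gridPoint (t : ℝ≥0) (N i : ℕ) : (gridPoint t N i : ℝ) = t * (i / N) := by
  simp [gridPoint]

lemma gridPoint_zero (t : ℝ≥0) (N : ℕ) : gridPoint t N 0 = 0 := by simp [gridPoint]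

lemma gridPoint_self (t : ℝ≥0) {N : ℕ} (hN : N ≠ 0) : gridPoint t N N = t := by
  have : (N : ℝ≥0) ≠ 0 := by exact_mod_cast hN
  simp [gridPoint, this]

lemma gridPoint_mono (t : ℝ≥0) (N : ℕ) : Monotone (gridPoint t N) := fun i j hij => by
  unfold gridPoint
  gcongr

lemma gridPoint_le (t : ℝ≥0) {N i : ℕ} (hN : N ≠ 0) (hi : i ≤ N) : gridPoint t N i ≤ t :=
  (gridPoint_mono t N hi).trans (gridPoint_self t hN).le

lemma gridPoint_succ_sub (t : ℝ≥0) (N i : ℕ) :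
    (gridPoint t N (i + 1) : ℝ) - gridPoint t N i = t / N := by
  rw [coe_gridPoint, coe_gridPoint]
  push_cast
  ring

lemma gridPoint_two_mul (t : ℝ≥0) (N i : ℕ) : gridPoint t (2 * N) (2 * i) = gridPoint t N i := by
  unfold gridPoint
  push_cast
  rw [mul_div_mul_left _ _ two_ne_zero]

/-- The step function taking, on each interval of the uniform partition, the value of `q` at the
left end point. -/
noncomputable def leftStep (q : ℝ → ℝ) (t : ℝ≥0) (N : ℕ) : ℝ≥0 →₀ ℝ :=
  ∑ i ∈ Finset.range N, q (gridPoint t N i) •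
    (Finsupp.single (gridPoint t N (i + 1)) 1 - Finsupp.single (gridPoint t N i) 1)

lemma linearCombination_leftStep {M : Type*} [AddCommGroup M] [Module ℝ M] (w : ℝ≥0 → M)
    (q : ℝ → ℝ) (t : ℝ≥0) (N : ℕ) : Finsupp.linearCombination ℝ w (leftStep q t N) =
      ∑ i ∈ Finset.range N, q (gridPoint t N i) •
        (w (gridPoint t N (i + 1)) - w (gridPoint t N i)) := by
  simp [leftStep, map_sum]

lemma leftStep_support_le (q : ℝ → ℝ) (t : ℝ≥0) {N : ℕ} (hN : N ≠ 0) :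
    ∀ a ∈ (leftStep q t N).support, a ≤ t := by
  intro a ha
  by_contra hat
  rw [Finsupp.mem_support_iff] at ha
  refine ha ?_
  simp only [leftStep, Finsupp.finsetSum_apply]
  refine Finset.sum_eq_zero fun i hi => ?_
  have hi := Finset.mem_range.1 hi
  have h1 : gridPoint t N i ≠ a := fun h => hat (h ▸ gridPoint_le t hN hi.le)
  have h2 : gridPoint t N (i + 1) ≠ a := fun h => hat (h ▸ gridPoint_le t hN hi)
  simp [h1, h2]

variable {q : ℝ → ℝ} {t : ℝ≥0}

lemma sum_gridPoint_increments_le (hq0 : ∀ r ∈ Set.Icc (0 : ℝ) t, 0 ≤ q r)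
    (hq1 : ∀ r ∈ Set.Icc (0 : ℝ) t, q r ≤ 1) {N : ℕ} (hN : N ≠ 0) :
    ∑ i ∈ Finset.range N, (q (gridPoint t N (i + 1)) - q (gridPoint t N i)) ≤ 1 := by
  rw [Finset.sum_range_sub fun i => q (gridPoint t N i), gridPoint_self t hN, gridPoint_zero]
  have h0 := hq0 0 ⟨le_rfl, t.2⟩
  have h1 := hq1 t ⟨t.2, le_rfl⟩
  simp only [NNReal.coe_zero]
  linarith

lemma gridPoint_mem (t : ℝ≥0) {N i : ℕ} (hN : N ≠ 0) (hi : i ≤ N) :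
    (gridPoint t N i : ℝ) ∈ Set.Icc (0 : ℝ) t :=
  ⟨(gridPoint t N i).2, NNReal.coe_le_coe.2 (gridPoint_le t hN hi)⟩

lemma increment_nonneg (hq : MonotoneOn q (Set.Icc 0 t)) {N i j : ℕ} (hN : N ≠ 0) (hij : i ≤ j)
    (hj : j ≤ N) : 0 ≤ q (gridPoint t N j) - q (gridPoint t N i) :=
  sub_nonneg.2 <| hq (gridPoint_mem t hN (hij.trans hj)) (gridPoint_mem t hN hj)
    (NNReal.coe_le_coe.2 (gridPoint_mono t N hij))

lemma indicator_Ioc_zero_sub {a b : ℝ} (h0 : 0 ≤ a) (hab : a ≤ b) (r : ℝ) :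
    (Set.Ioc 0 b).indicator (1 : ℝ → ℝ) r - (Set.Ioc 0 a).indicator 1 r
      = (Set.Ioc a b).indicator 1 r := by
  simp only [Set.indicator_apply, Set.mem_Ioc, Pi.one_apply]
  split_ifs <;> first | (exfalso; grind) | norm_num

lemma abs_stepFun_leftStep_sub_le (hq : MonotoneOn q (Set.Icc 0 t)) {N : ℕ} (hN : N ≠ 0) {r : ℝ}
    (hr : r ∈ Set.Ioc (0 : ℝ) t) : |stepFun (leftStep q t N) r - q r| ≤
      ∑ i ∈ Finset.range N, (Set.Ioc (gridPoint t N i : ℝ) (gridPoint t N (i + 1))).indicator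
        (fun _ => q (gridPoint t N (i + 1)) - q (gridPoint t N i)) r := by
  have hind : ∀ i, (Set.Ioc (0 : ℝ) (gridPoint t N (i + 1))).indicator (1 : ℝ → ℝ) r
      - (Set.Ioc (0 : ℝ) (gridPoint t N i)).indicator 1 r
      = (Set.Ioc (gridPoint t N i : ℝ) (gridPoint t N (i + 1))).indicator 1 r := fun i =>
    indicator_Ioc_zero_sub (gridPoint t N i).2
      (NNReal.coe_le_coe.2 (gridPoint_mono t N i.le_succ)) r
  have h1 : ∑ i ∈ Finset.range N,
      (Set.Ioc (gridPoint t N i : ℝ) (gridPoint t N (i + 1))).indicator (1 : ℝ → ℝ) r = 1 := by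
    simp only [← hind]
    rw [Finset.sum_range_sub fun i => (Set.Ioc (0 : ℝ) (gridPoint t N i)).indicator (1 : ℝ → ℝ) r,
      gridPoint_self t hN, gridPoint_zero]
    simp [hr.1, hr.2]
  have h2 : stepFun (leftStep q t N) r - q r = ∑ i ∈ Finset.range N, (q (gridPoint t N i) - q r) *
      (Set.Ioc (gridPoint t N i : ℝ) (gridPoint t N (i + 1))).indicator 1 r := by
    rw [stepFun_eq_linearCombination, linearCombination_leftStep]
    simp only [hind, smul_eq_mul, sub_mul, Finset.sum_sub_distrib]
    rw [← Finset.mul_sum, h1, mul_one]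
  rw [h2]
  refine (Finset.abs_sum_le_sum_abs _ _).trans (Finset.sum_le_sum fun i hi => ?_)
  have hi := Finset.mem_range.1 hi
  by_cases hri : r ∈ Set.Ioc (gridPoint t N i : ℝ) (gridPoint t N (i + 1))
  · have ha := hq (gridPoint_mem t hN hi.le) (Set.Ioc_subset_Icc_self hr) hri.1.le
    have hb := hq (Set.Ioc_subset_Icc_self hr) (gridPoint_mem t hN hi) hri.2
    rw [Set.indicator_of_mem hri, Set.indicator_of_mem hri, Pi.one_apply, mul_one, abs_le]
    constructor <;> linarith
  · simp [Set.indicator_of_notMem hri]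

/-- On each cell the error is at most the increment of `q`, with `L²` norm at most increment times
`(t/N)^{1/2}`. The increments sum to at most `1`, so `q` need not be continuous. -/
lemma eLpNorm_stepFun_leftStep_sub_le (hq : MonotoneOn q (Set.Icc 0 t))
    (hq0 : ∀ r ∈ Set.Icc (0 : ℝ) t, 0 ≤ q r) (hq1 : ∀ r ∈ Set.Icc (0 : ℝ) t, q r ≤ 1) {N : ℕ}
    (hN : N ≠ 0) : eLpNorm (fun r => stepFun (leftStep q t N) r - q r) 2
      (volume.restrict (Set.Ioc (0 : ℝ) t)) ≤ ENNReal.ofReal (t / N) ^ (1 / 2 : ℝ) := by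
  set μ := (volume : Measure ℝ).restrict (Set.Ioc (0 : ℝ) t)
  set F : ℕ → ℝ → ℝ := fun i =>
    (Set.Ioc (gridPoint t N i : ℝ) (gridPoint t N (i + 1))).indicator
      (fun _ => q (gridPoint t N (i + 1)) - q (gridPoint t N i)) with hF
  calc eLpNorm (fun r => stepFun (leftStep q t N) r - q r) 2 μ
      ≤ eLpNorm (∑ i ∈ Finset.range N, F i) 2 μ := by
        refine eLpNorm_mono_ae ?_
        filter_upwards [ae_restrict_mem measurableSet_Ioc] with r hr
        rw [Finset.sum_apply]
        exact (abs_stepFun_leftStep_sub_le hq hN hr).trans (le_abs_self _)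
    _ ≤ ∑ i ∈ Finset.range N, eLpNorm (F i) 2 μ :=
        eLpNorm_sum_le (fun i _ => (measurable_const.indicator measurableSet_Ioc
          ).aestronglyMeasurable) one_le_two
    _ ≤ ∑ i ∈ Finset.range N, ENNReal.ofReal (q (gridPoint t N (i + 1)) - q (gridPoint t N i)) *
          ENNReal.ofReal (t / N) ^ (1 / 2 : ℝ) := by
        refine Finset.sum_le_sum fun i hi => ?_
        have hi := Finset.mem_range.1 hi
        refine (eLpNorm_indicator_const_le _ _).trans ?_
        rw [Real.enorm_of_nonneg (increment_nonneg hq hN i.le_succ hi), ENNReal.toReal_ofNat]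
        gcongr
        refine (Measure.restrict_apply_le _ _).trans ?_
        rw [Real.volume_Ioc, gridPoint_succ_sub]
    _ ≤ ENNReal.ofReal (t / N) ^ (1 / 2 : ℝ) := by
        rw [← Finset.sum_mul, ← ENNReal.ofReal_sum_of_nonneg fun i hi =>
          increment_nonneg hq hN i.le_succ (Finset.mem_range.1 hi)]
        refine mul_le_of_le_one_left' ?_
        exact ENNReal.ofReal_le_one.2 (sum_gridPoint_increments_le hq0 hq1 hN)

lemma sum_range_two_mul {M : Type*} [AddCommMonoid M] (f : ℕ → M) (N : ℕ) :
    ∑ i ∈ Finset.range (2 * N), f i = ∑ i ∈ Finset.range N, (f (2 * i) + f (2 * i + 1)) := by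
  induction N with
  | zero => simp
  | succ N ih =>
    rw [mul_add, mul_one, Finset.sum_range_succ, Finset.sum_range_succ, ih, Finset.sum_range_succ,
      add_assoc]

lemma sum_smul_sub_eq {M : Type*} [AddCommGroup M] [Module ℝ M] (u : ℕ → ℝ) (Y : ℕ → M) (n : ℕ) :
    ∑ i ∈ Finset.range n, u i • (Y i - Y (i + 1)) =
      u 0 • Y 0 + ∑ i ∈ Finset.range n, (u (i + 1) - u i) • Y (i + 1) - u n • Y n := by
  induction n with
  | zero => simp
  | succ n ih =>
    rw [Finset.sum_range_succ, ih, Finset.sum_range_succ]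
    module

/-- Summation by parts: a sum with nonnegative nondecreasing weights is dominated by the sum of the
same weights against the decrements of a bound of the remainders. -/
lemma norm_sum_smul_sub_le {M : Type*} [NormedAddCommGroup M] [NormedSpace ℝ M] {u : ℕ → ℝ}
    {X : ℕ → M} {d : ℕ → ℝ} {n : ℕ} (hu0 : 0 ≤ u 0) (hu : ∀ i < n, 0 ≤ u (i + 1) - u i)
    (hd : ∀ i ≤ n, ‖X n - X i‖ ≤ d i) (hdn : d n = 0) :
    ‖∑ i ∈ Finset.range n, u i • (X (i + 1) - X i)‖ ≤
      ∑ i ∈ Finset.range n, u i * (d i - d (i + 1)) := by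
  have h1 : ∑ i ∈ Finset.range n, u i • (X (i + 1) - X i)
      = u 0 • (X n - X 0) + ∑ i ∈ Finset.range n, (u (i + 1) - u i) • (X n - X (i + 1)) := by
    -- Summing by parts with the remainders `X n - X i`, which vanish at `i = n`, makes all weights
    -- nonnegative; the same identity for `d` then reverses the summation.
    have h := sum_smul_sub_eq u (fun i => X n - X i) n
    simp only [sub_sub_sub_cancel_left, sub_self, smul_zero, sub_zero] at h
    exact h
  have h2 := sum_smul_sub_eq u d n
  simp only [smul_eq_mul, hdn, mul_zero, sub_zero] at h2
  rw [h1, h2]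
  refine (norm_add_le _ _).trans (add_le_add ?_ ((norm_sum_le _ _).trans
    (Finset.sum_le_sum fun i hi => ?_)))
  · rw [norm_smul, Real.norm_of_nonneg hu0]
    exact mul_le_mul_of_nonneg_left (hd 0 n.zero_le) hu0
  · have hi := Finset.mem_range.1 hi
    rw [norm_smul, Real.norm_of_nonneg (hu i hi)]
    exact mul_le_mul_of_nonneg_left (hd _ hi) (hu i hi)

/-- Finite-difference form of `u^{-κ} d(u^H) = H/(H-κ) d(u^{H-κ})`. By homogeneity `y = xs`, and the
claim is Bernoulli's inequality with exponent `H/(H-κ) ≥ 1`. -/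
lemma rpow_neg_mul_rpow_sub_le {H κ x y : ℝ} (hκ : 0 ≤ κ) (hκH : κ < H) (hx : 0 < x) (hy : 0 ≤ y) :
    x ^ (-κ) * (x ^ H - y ^ H) ≤ H / (H - κ) * (x ^ (H - κ) - y ^ (H - κ)) := by
  have hp : 0 < H - κ := by linarith
  obtain ⟨s, hs, rfl⟩ : ∃ s, 0 ≤ s ∧ y = x * s := ⟨y / x, by positivity, by field_simp⟩
  have hB := one_add_mul_self_le_rpow_one_add (s := s ^ (H - κ) - 1)
    (by linarith [Real.rpow_nonneg hs (H - κ)]) (p := H / (H - κ))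
    (by rw [one_le_div hp]; linarith)
  rw [add_sub_cancel, ← Real.rpow_mul hs, mul_div_cancel₀ _ hp.ne'] at hB
  have e : x ^ (-κ) * x ^ H = x ^ (H - κ) := by rw [← Real.rpow_add hx]; ring_nf
  rw [Real.mul_rpow hx.le hs, Real.mul_rpow hx.le hs]
  calc x ^ (-κ) * (x ^ H - x ^ H * s ^ H) = x ^ (H - κ) * (1 - s ^ H) := by rw [← e]; ring
    _ ≤ x ^ (H - κ) * (H / (H - κ) * (1 - s ^ (H - κ))) := by gcongr; linarith
    _ = _ := by ring

variable {E : Type*} [NormedAddCommGroup E] [InnerProductSpace ℝ E] {H : ℝ} {w : ℝ≥0 → E}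

/-- The remainder `w t - w r` has norm `(t-r)^H`, so summation by parts leads to a sum that
telescopes after the Bernoulli estimate. -/
lemma IsFBMCurve.norm_leftStep_le (hw : IsFBMCurve H w) (hq : MonotoneOn q (Set.Icc 0 t))
    (hq0 : ∀ r ∈ Set.Icc (0 : ℝ) t, 0 ≤ q r) (ht : 0 < t) {B κ : ℝ} (hB : 0 ≤ B) (hκ : 0 ≤ κ)
    (hκH : κ < H) (hqB : ∀ r ∈ Set.Ico (0 : ℝ) t, q r ≤ B * ((t : ℝ) - r) ^ (-κ)) {N : ℕ}
    (hN : N ≠ 0) : ‖Finsupp.linearCombination ℝ w (leftStep q t N)‖ ≤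
      B * (H / (H - κ) * (t : ℝ) ^ (H - κ)) := by
  have hH : 0 < H := by linarith
  have hp : 0 < H - κ := by linarith
  have hNpos : (0 : ℝ) < N := by exact_mod_cast Nat.pos_of_ne_zero hN
  have htpos : (0 : ℝ) < t := ht
  rw [linearCombination_leftStep]
  refine (norm_sum_smul_sub_le (d := fun i => ((t : ℝ) - gridPoint t N i) ^ H)
    (u := fun i => q (gridPoint t N i)) (X := fun i => w (gridPoint t N i))
    (hq0 _ (gridPoint_mem t hN N.zero_le))
    (fun i hi => increment_nonneg hq hN i.le_succ hi) (fun i hi => ?_) ?_).trans ?_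
  · rw [hw.norm_sub hH, gridPoint_self t hN,
      abs_of_nonneg (sub_nonneg.2 (gridPoint_mem t hN hi).2)]
  · simp [gridPoint_self t hN, Real.zero_rpow hH.ne']
  calc _ ≤ ∑ i ∈ Finset.range N, B * (H / (H - κ)) * (((t : ℝ) - gridPoint t N i) ^ (H - κ)
        - ((t : ℝ) - gridPoint t N (i + 1)) ^ (H - κ)) := by
        refine Finset.sum_le_sum fun i hi => ?_
        have hi := Finset.mem_range.1 hi
        -- Left endpoints stay away from `t`, where the bound on `q` is singular.
        have hlt : (gridPoint t N i : ℝ) < t := by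
          have := gridPoint_succ_sub t N i
          have h2 := (gridPoint_mem t hN (i := i + 1) hi).2
          have : 0 < (t : ℝ) / N := by positivity
          linarith
        have hy : 0 ≤ (t : ℝ) - gridPoint t N (i + 1) := sub_nonneg.2 (gridPoint_mem t hN hi).2
        have hdec : 0 ≤ ((t : ℝ) - gridPoint t N i) ^ H
            - ((t : ℝ) - gridPoint t N (i + 1)) ^ H := by
          rw [sub_nonneg]
          gcongr
          exact gridPoint_mono t N i.le_succ
        calc _ ≤ B * ((t : ℝ) - gridPoint t N i) ^ (-κ) * (((t : ℝ) - gridPoint t N i) ^ H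
            - ((t : ℝ) - gridPoint t N (i + 1)) ^ H) :=
              mul_le_mul_of_nonneg_right (hqB _ ⟨(gridPoint t N i).2, hlt⟩) hdec
          _ ≤ _ := by
            rw [mul_assoc, mul_assoc]
            exact mul_le_mul_of_nonneg_left
              (rpow_neg_mul_rpow_sub_le hκ hκH (sub_pos.2 hlt) hy) hB
    _ = _ := by
        rw [← Finset.mul_sum,
          Finset.sum_range_sub' fun i => ((t : ℝ) - gridPoint t N i) ^ (H - κ),
          gridPoint_self t hN, gridPoint_zero, sub_self, Real.zero_rpow hp.ne', NNReal.coe_zero]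
        ring_nf

/-- Halving the cells changes the integrand only on right halves, by increments of `q` of total at
most `1`; each increment of `w` there has norm `(t/(2N))^H`. -/
lemma IsFBMCurve.norm_leftStep_two_mul_sub_le (hw : IsFBMCurve H w) (hH : 0 < H)
    (hq : MonotoneOn q (Set.Icc 0 t)) (hq0 : ∀ r ∈ Set.Icc (0 : ℝ) t, 0 ≤ q r)
    (hq1 : ∀ r ∈ Set.Icc (0 : ℝ) t, q r ≤ 1) {N : ℕ} (hN : N ≠ 0) :
    ‖Finsupp.linearCombination ℝ w (leftStep q t (2 * N)) -
      Finsupp.linearCombination ℝ w (leftStep q t N)‖ ≤ ((t : ℝ) / (2 * N)) ^ H := by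
  have hN2 : 2 * N ≠ 0 := by omega
  have hS : Finsupp.linearCombination ℝ w (leftStep q t (2 * N)) -
      Finsupp.linearCombination ℝ w (leftStep q t N) = ∑ i ∈ Finset.range N,
      (q (gridPoint t (2 * N) (2 * i + 1)) - q (gridPoint t (2 * N) (2 * i))) •
        (w (gridPoint t (2 * N) (2 * i + 1 + 1)) - w (gridPoint t (2 * N) (2 * i + 1))) := by
    rw [linearCombination_leftStep, linearCombination_leftStep, sum_range_two_mul,
      ← Finset.sum_sub_distrib]
    refine Finset.sum_congr rfl fun i _ => ?_
    rw [← gridPoint_two_mul t N i, ← gridPoint_two_mul t N (i + 1),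
      show 2 * (i + 1) = 2 * i + 1 + 1 by ring]
    module
  rw [hS]
  calc _ ≤ ∑ i ∈ Finset.range N, (q (gridPoint t N (i + 1)) - q (gridPoint t N i)) *
        ((t : ℝ) / (2 * N)) ^ H := by
        refine (norm_sum_le _ _).trans (Finset.sum_le_sum fun i hi => ?_)
        have hi := Finset.mem_range.1 hi
        have h1 := increment_nonneg hq hN2 (Nat.le_succ (2 * i)) (by omega)
        have h2 := increment_nonneg hq hN2 (Nat.le_succ (2 * i + 1)) (by omega)
        simp only [Nat.succ_eq_add_one] at h1 h2
        rw [norm_smul, Real.norm_of_nonneg h1, hw.norm_sub hH, gridPoint_succ_sub,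
          abs_of_nonneg (by positivity)]
        push_cast
        refine mul_le_mul_of_nonneg_right ?_ (by positivity)
        rw [← gridPoint_two_mul t N i, ← gridPoint_two_mul t N (i + 1),
          show 2 * (i + 1) = 2 * i + 1 + 1 by ring]
        linarith
    _ ≤ _ := by
        rw [← Finset.sum_mul]
        exact mul_le_of_le_one_left (by positivity) (sum_gridPoint_increments_le hq0 hq1 hN)

/-- Existence of, and a bound for, the Wiener integral of a monotone function. -/
theorem IsFBMCurve.exists_integral_monotoneOn [CompleteSpace E] (hw : IsFBMCurve H w) (hH : 0 < H)
    (ht : 0 < t) (hq : MonotoneOn q (Set.Icc 0 t)) (hq0 : ∀ r ∈ Set.Icc (0 : ℝ) t, 0 ≤ q r)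
    (hq1 : ∀ r ∈ Set.Icc (0 : ℝ) t, q r ≤ 1) :
    ∃ (J : E) (c : ℕ → ℝ≥0 →₀ ℝ), (∀ m, ∀ a ∈ (c m).support, a ≤ t) ∧
      Tendsto (fun m => eLpNorm (fun r => stepFun (c m) r - q r) 2
        (volume.restrict (Set.Ioc (0 : ℝ) t))) atTop (𝓝 0) ∧
      Tendsto (fun m => Finsupp.linearCombination ℝ w (c m)) atTop (𝓝 J) ∧
      ∀ B κ : ℝ, 0 ≤ B → 0 ≤ κ → κ < H →
        (∀ r ∈ Set.Ico (0 : ℝ) t, q r ≤ B * ((t : ℝ) - r) ^ (-κ)) →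
        ‖J‖ ≤ B * (H / (H - κ) * (t : ℝ) ^ (H - κ)) := by
  have hpow : ∀ m : ℕ, 2 ^ m ≠ 0 := fun m => by positivity
  -- Dyadic refinement makes the errors geometric with ratio `2^{-H} < 1`, for any `H > 0`.
  have hcauchy : CauchySeq fun m : ℕ =>
      Finsupp.linearCombination ℝ w (leftStep q t (2 ^ m)) := by
    refine cauchySeq_of_le_geometric ((1 / 2 : ℝ) ^ H) (((t : ℝ) / 2) ^ H)
      (Real.rpow_lt_one (by norm_num) (by norm_num) hH) fun m => ?_
    rw [dist_comm, dist_eq_norm, pow_succ', ← Real.rpow_mul_natCast (by norm_num), mul_comm H,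
      Real.rpow_natCast_mul (by norm_num), ← Real.mul_rpow (by positivity) (by positivity)]
    refine (hw.norm_leftStep_two_mul_sub_le hH hq hq0 hq1 (hpow m)).trans_eq ?_
    congr 1
    push_cast
    rw [one_div_pow]
    field_simp
  obtain ⟨J, hJ⟩ := cauchySeq_tendsto_of_complete hcauchy
  refine ⟨J, fun m => leftStep q t (2 ^ m), fun m => leftStep_support_le q t (hpow m), ?_, hJ,
    fun B κ hB hκ hκH hqB => le_of_tendsto' hJ.norm fun m =>
      hw.norm_leftStep_le hq hq0 ht hB hκ hκH hqB (hpow m)⟩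
  have hlim : Tendsto (fun m : ℕ => ENNReal.ofReal ((t : ℝ) / (2 ^ m : ℕ)) ^ (1 / 2 : ℝ)) atTop
      (𝓝 0) := by
    have h1 : Tendsto (fun m : ℕ => (t : ℝ) / (2 ^ m : ℕ)) atTop (𝓝 0) := by
      push_cast
      exact tendsto_const_nhds.div_atTop (tendsto_pow_atTop_atTop_of_one_lt one_lt_two)
    have h2 := (ENNReal.continuous_rpow_const (y := (1 / 2 : ℝ))).continuousAt.tendsto.comp
      (ENNReal.tendsto_ofReal h1)
    simpa [Function.comp_def] using h2
  exact tendsto_of_tendsto_of_tendsto_of_le_of_le tendsto_const_nhds hlim (fun _ => zero_le)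
    fun m => eLpNorm_stepFun_leftStep_sub_le hq hq0 hq1 (hpow m)

end MonotoneIntegrand

/-! ### From Hilbert space curves to Wiener integrals in `L²(Ω)`. -/

section Probability

variable {Ω : Type*} [MeasurableSpace Ω] {P : Measure Ω} {H : ℝ} {W : ℝ≥0 → Ω → ℝ}

lemma IsFBM.memLp (hW : IsFBM P H W) (t : ℝ≥0) : MemLp (W t) 2 P :=
  (hW.gaussian.hasGaussianLaw_eval t).memLp_two

/-- Fractional Brownian motion as a curve in `L²(Ω)`. -/
noncomputable def IsFBM.curve (hW : IsFBM P H W) (t : ℝ≥0) : Lp ℝ 2 P := (hW.memLp t).toLp (W t)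

lemma inner_toLp_toLp {X : Type*} [MeasurableSpace X] {μ : Measure X} {F : Type*}
    [NormedAddCommGroup F] [InnerProductSpace ℝ F] {f g : X → F} (hf : MemLp f 2 μ)
    (hg : MemLp g 2 μ) : inner ℝ (hf.toLp f) (hg.toLp g) = ∫ x, inner ℝ (f x) (g x) ∂μ := by
  rw [L2.inner_def]
  refine integral_congr_ae ?_
  filter_upwards [hf.coeFn_toLp, hg.coeFn_toLp] with x h1 h2
  rw [h1, h2]

lemma IsFBM.isFBMCurve (hW : IsFBM P H W) : IsFBMCurve H hW.curve := by
  intro a b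
  rw [IsFBM.curve, IsFBM.curve, inner_toLp_toLp, ← hW.covar a b]
  refine integral_congr_ae (ae_of_all _ fun ω => ?_)
  simp [mul_comm]

lemma IsFBM.coeFn_linearCombination (hW : IsFBM P H W) (c : ℝ≥0 →₀ ℝ) :
    (Finsupp.linearCombination ℝ hW.curve c : Lp ℝ 2 P) =ᵐ[P] stepIntegral W c := by
  rw [Finsupp.linearCombination_apply, Finsupp.sum]
  have h : ∀ᵐ ω ∂P, ∀ a ∈ c.support, (c a • hW.curve a : Lp ℝ 2 P) ω = c a * W a ω := by
    rw [eventually_all_finset]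
    intro a _
    filter_upwards [Lp.coeFn_smul (c a) (hW.curve a), (hW.memLp a).coeFn_toLp] with ω h1 h2
    rw [h1, Pi.smul_apply, smul_eq_mul, IsFBM.curve, h2]
  filter_upwards [h, Lp.coeFn_fun_finsetSum c.support fun a => c a • hW.curve a] with ω h1 h2
  rw [h2, stepIntegral, Finsupp.sum]
  exact Finset.sum_congr rfl h1

lemma IsFBM.tendsto_linearCombination_iff (hW : IsFBM P H W) (c : ℕ → ℝ≥0 →₀ ℝ) {J : Ω → ℝ}
    (hJ : MemLp J 2 P) :
    Tendsto (fun m => Finsupp.linearCombination ℝ hW.curve (c m)) atTop (𝓝 (hJ.toLp J)) ↔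
      Tendsto (fun m => eLpNorm (fun ω => stepIntegral W (c m) ω - J ω) 2 P) atTop (𝓝 0) := by
  rw [Lp.tendsto_Lp_iff_tendsto_eLpNorm]
  refine tendsto_congr fun m => eLpNorm_congr_ae ?_
  filter_upwards [hW.coeFn_linearCombination (c m)] with ω h
  rw [Pi.sub_apply, h]

/-- The Wiener integral is unique. -/
lemma IsFBM.toLp_eq_of_isWienerIntegral (hW : IsFBM P H W) (hH : 0 < H) {t : ℝ≥0} {q : ℝ → ℝ}
    {J : Ω → ℝ} (hJ : IsWienerIntegral P W t q J) {J' : Lp ℝ 2 P} {c : ℕ → ℝ≥0 →₀ ℝ}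
    (hc : ∀ m, ∀ a ∈ (c m).support, a ≤ t)
    (hcq : Tendsto (fun m => eLpNorm (fun r => stepFun (c m) r - q r) 2
      (volume.restrict (Set.Ioc (0 : ℝ) t))) atTop (𝓝 0))
    (hcJ : Tendsto (fun m => Finsupp.linearCombination ℝ hW.curve (c m)) atTop (𝓝 J')) :
    hJ.2.1.toLp J = J' := by
  obtain ⟨hq, hJL, d, hd, hdq, hdJ⟩ := hJ
  have hdJ' := (hW.tendsto_linearCombination_iff d hJL).2 hdJ
  have hsub := hdJ'.sub hcJ
  simp only [← map_sub] at hsub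
  -- The difference of two approximating sequences consists of step functions tending to `0` in
  -- `L²(0,t)`.
  refine sub_eq_zero.1 (hW.isFBMCurve.closable hH (t := t) (fun m a ha => ?_) ?_ hsub)
  · have := Finsupp.support_sub ha
    rcases Finset.mem_union.1 this with h | h
    exacts [hd m a h, hc m a h]
  · have hsum := hdq.add hcq
    rw [add_zero] at hsum
    refine tendsto_of_tendsto_of_tendsto_of_le_of_le tendsto_const_nhds hsum (fun _ => zero_le)
      fun m => ?_
    have e : stepFun (d m - c m) = (fun r => stepFun (d m) r - q r)
        - fun r => stepFun (c m) r - q r := by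
      ext r
      rw [stepFun_sub, Pi.sub_apply]
      ring
    rw [e]
    exact eLpNorm_sub_le ((measurable_stepFun _).aestronglyMeasurable.sub hq.1)
      ((measurable_stepFun _).aestronglyMeasurable.sub hq.1) one_le_two

lemma memLp_two_of_monotoneOn {q : ℝ → ℝ} {t : ℝ} (hq : MonotoneOn q (Set.Icc 0 t))
    (hq0 : ∀ r ∈ Set.Icc (0 : ℝ) t, 0 ≤ q r) (hq1 : ∀ r ∈ Set.Icc (0 : ℝ) t, q r ≤ 1) :
    MemLp q 2 (volume.restrict (Set.Ioc 0 t)) := by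
  refine MemLp.of_bound (C := 1) ?_ ?_
  · exact (aemeasurable_restrict_of_monotoneOn measurableSet_Ioc
      (hq.mono Set.Ioc_subset_Icc_self)).aestronglyMeasurable
  · filter_upwards [ae_restrict_mem measurableSet_Ioc] with r hr
    have hrI := Set.Ioc_subset_Icc_self hr
    exact (Real.norm_of_nonneg (hq0 r hrI)).trans_le (hq1 r hrI)

/-- The Wiener integral of a monotone function exists. -/
theorem IsFBM.exists_isWienerIntegral (hW : IsFBM P H W) (hH : 0 < H) {t : ℝ≥0} (ht : 0 < t)
    {q : ℝ → ℝ} (hq : MonotoneOn q (Set.Icc 0 t)) (hq0 : ∀ r ∈ Set.Icc (0 : ℝ) t, 0 ≤ q r)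
    (hq1 : ∀ r ∈ Set.Icc (0 : ℝ) t, q r ≤ 1) : ∃ J : Ω → ℝ, IsWienerIntegral P W t q J := by
  obtain ⟨J, c, hc, hcq, hcJ, -⟩ := hW.isFBMCurve.exists_integral_monotoneOn hH ht hq hq0 hq1
  refine ⟨J, memLp_two_of_monotoneOn hq hq0 hq1, Lp.memLp J, c, hc, hcq, ?_⟩
  refine (hW.tendsto_linearCombination_iff c (Lp.memLp J)).1 ?_
  rwa [Lp.toLp_coeFn]

/-- The norm of the Wiener integral of a monotone function. -/
theorem IsFBM.norm_toLp_le (hW : IsFBM P H W) (hH : 0 < H) {t : ℝ≥0} (ht : 0 < t)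
    {q : ℝ → ℝ} (hq : MonotoneOn q (Set.Icc 0 t)) (hq0 : ∀ r ∈ Set.Icc (0 : ℝ) t, 0 ≤ q r)
    (hq1 : ∀ r ∈ Set.Icc (0 : ℝ) t, q r ≤ 1) {J : Ω → ℝ} (hJ : IsWienerIntegral P W t q J)
    {B κ : ℝ} (hB : 0 ≤ B) (hκ : 0 ≤ κ) (hκH : κ < H)
    (hqB : ∀ r ∈ Set.Ico (0 : ℝ) t, q r ≤ B * ((t : ℝ) - r) ^ (-κ)) :
    ‖hJ.2.1.toLp J‖ ≤ B * (H / (H - κ) * (t : ℝ) ^ (H - κ)) := by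
  obtain ⟨J', c, hc, hcq, hcJ, hbd⟩ := hW.isFBMCurve.exists_integral_monotoneOn hH ht hq hq0 hq1
  rw [hW.toLp_eq_of_isWienerIntegral hH hJ hc hcq hcJ]
  exact hbd B κ hB hκ hκH hqB

end Probability

/-! ### Positivity of the Dirichlet eigenvalues -/

section Dirichlet

variable {n : ℕ} {D : Opens (EuclideanSpace ℝ (Fin n))}

lemma continuous_gradient_testFunction (v : TestFunction D ℝ (⊤ : ℕ∞)) :
    Continuous (gradient v) := by
  have h : Continuous (fderiv ℝ v) := v.contDiff.continuous_fderiv (by simp)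
  exact (InnerProductSpace.toDual ℝ (EuclideanSpace ℝ (Fin n))).symm.continuous.comp h

lemma hasCompactSupport_gradient_testFunction (v : TestFunction D ℝ (⊤ : ℕ∞)) :
    HasCompactSupport (gradient v) :=
  (v.hasCompactSupport.fderiv (𝕜 := ℝ)).comp_left
    (g := (InnerProductSpace.toDual ℝ (EuclideanSpace ℝ (Fin n))).symm) (map_zero _)

lemma hasCompactSupport_sq_testFunction (v : TestFunction D ℝ (⊤ : ℕ∞)) :
    HasCompactSupport fun x => v x ^ 2 := by
  refine v.hasCompactSupport.mono fun x hx => ?_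
  rw [Function.mem_support] at hx ⊢
  exact fun h => hx (by rw [h]; norm_num)

lemma integrable_sq_testFunction (v : TestFunction D ℝ (⊤ : ℕ∞)) :
    Integrable (fun x => v x ^ 2) volume :=
  Continuous.integrable_of_hasCompactSupport (v.continuous.pow 2)
    (hasCompactSupport_sq_testFunction v)

lemma integrable_sq_norm_gradient_testFunction (v : TestFunction D ℝ (⊤ : ℕ∞)) :
    Integrable (fun x => ‖gradient v x‖ ^ 2) volume := by
  refine Continuous.integrable_of_hasCompactSupport
    ((continuous_gradient_testFunction v).norm.pow 2)
    ((hasCompactSupport_gradient_testFunction v).mono fun x hx => ?_)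
  rw [Function.mem_support] at hx ⊢
  exact fun h => hx (by rw [h, norm_zero]; norm_num)

/-- The Poincaré inequality for test functions. -/
lemma integral_sq_testFunction_le (hn : 1 ≤ n) {R : ℝ}
    (hR : ∀ x ∈ (D : Set (EuclideanSpace ℝ (Fin n))), ‖x‖ ≤ R) (v : TestFunction D ℝ (⊤ : ℕ∞)) :
    ∫ x in (D : Set (EuclideanSpace ℝ (Fin n))), v x ^ 2 ≤
      4 * R ^ 2 * ∫ x in (D : Set (EuclideanSpace ℝ (Fin n))), ‖gradient v x‖ ^ 2 := by
  set e : EuclideanSpace ℝ (Fin n) := EuclideanSpace.single ⟨0, hn⟩ (1 : ℝ) with he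
  have hen : ‖e‖ = 1 := by simp [he]
  have hvd : ∀ x, DifferentiableAt ℝ v x := fun x =>
    (v.contDiff.differentiable (by simp)).differentiableAt
  have hv0 : ∀ x, x ∉ (D : Set (EuclideanSpace ℝ (Fin n))) → v x = 0 := fun x hx =>
    image_eq_zero_of_notMem_tsupport fun h => hx (v.tsupport_subset h)
  have hfd : ∀ x, fderiv ℝ (fun x => inner ℝ e x) x e = 1 := by
    intro x
    have : fderiv ℝ (fun x => inner ℝ e x) x = innerSL ℝ e := (innerSL ℝ e).fderiv
    rw [this, innerSL_apply_apply, real_inner_self_eq_norm_sq, hen, one_pow]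
  have hgd : ∀ x, fderiv ℝ (fun x => v x ^ 2) x e = 2 * v x * inner ℝ (gradient v x) e := by
    intro x
    rw [fderiv_fun_pow 2 (hvd x)]
    simp [inner_gradient_left]
  have hci : Integrable (fun x => inner ℝ e x * fderiv ℝ (fun x => v x ^ 2) x e) volume := by
    simp only [hgd]
    have := continuous_gradient_testFunction v
    have := v.continuous
    refine Continuous.integrable_of_hasCompactSupport (by fun_prop)
      (v.hasCompactSupport.mono fun x hx => ?_)
    rw [Function.mem_support] at hx ⊢
    exact fun h => hx (by rw [h]; ring)
  have hfg : Integrable (fun x => inner ℝ e x * v x ^ 2) volume := by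
    refine Continuous.integrable_of_hasCompactSupport
      (Continuous.mul (by fun_prop) (v.continuous.pow 2))
      ((hasCompactSupport_sq_testFunction v).mono fun x hx => ?_)
    exact right_ne_zero_of_mul hx
  -- The weight `⟪e, x⟫` has derivative `1` along `e`, so `∫ v² = -∫ ⟪e, x⟫ 2v ∂ₑv`.
  have hibp := integral_mul_fderiv_eq_neg_fderiv_mul_of_integrable (μ := volume)
    (f := fun x => inner ℝ e x) (g := fun x => v x ^ 2) (v := e)
    (by simpa only [hfd, one_mul] using integrable_sq_testFunction v) hci
    hfg
    (fun x _ => (innerSL ℝ e).differentiableAt) (fun x _ => (hvd x).pow 2)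
  simp only [hfd, one_mul, hgd] at hibp hci
  have hD1 : ∫ x in (D : Set (EuclideanSpace ℝ (Fin n))),
      inner ℝ e x * (2 * v x * inner ℝ (gradient v x) e) =
      ∫ x, inner ℝ e x * (2 * v x * inner ℝ (gradient v x) e) :=
    setIntegral_eq_integral_of_forall_compl_eq_zero fun x hx => by simp [hv0 x hx]
  have hD2 : ∫ x in (D : Set (EuclideanSpace ℝ (Fin n))), v x ^ 2 = ∫ x, v x ^ 2 :=
    setIntegral_eq_integral_of_forall_compl_eq_zero fun x hx => by simp [hv0 x hx]
  have hgi := integrable_sq_norm_gradient_testFunction v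
  have hvi := integrable_sq_testFunction v
  -- Young's inequality with `|⟪e, x⟫| ≤ R`; absorbing `½∫v²` on the left turns `2R²` into `4R²`.
  have hmono : ∫ x in (D : Set (EuclideanSpace ℝ (Fin n))),
      -(inner ℝ e x * (2 * v x * inner ℝ (gradient v x) e)) ≤
      ∫ x in (D : Set (EuclideanSpace ℝ (Fin n))),
        (1 / 2 * v x ^ 2 + 2 * R ^ 2 * ‖gradient v x‖ ^ 2) := by
    refine setIntegral_mono_on hci.neg.integrableOn
      ((hvi.const_mul _).add (hgi.const_mul _)).integrableOn D.isOpen.measurableSet fun x hx => ?_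
    have h1 : |inner ℝ e x| ≤ R := by
      have := abs_real_inner_le_norm e x
      rw [hen, one_mul] at this
      exact this.trans (hR x hx)
    have h2 : |inner ℝ (gradient v x) e| ≤ ‖gradient v x‖ := by
      have := abs_real_inner_le_norm (gradient v x) e
      rwa [hen, mul_one] at this
    have h3 : (inner ℝ e x * inner ℝ (gradient v x) e) ^ 2 ≤ (R * ‖gradient v x‖) ^ 2 := by
      rw [← sq_abs, abs_mul]
      have hR0 : 0 ≤ R := (abs_nonneg _).trans h1
      gcongr
    nlinarith [sq_nonneg (v x + 2 * (inner ℝ e x * inner ℝ (gradient v x) e))]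
  rw [integral_neg, hD1, hibp, neg_neg, ← hD2, integral_add (hvi.const_mul _).integrableOn
    (hgi.const_mul _).integrableOn, integral_const_mul, integral_const_mul] at hmono
  linarith

/-- Eigenvalues of the Dirichlet Laplacian on a bounded open set are positive. -/
theorem IsDirichletEigen.pos (hn : 1 ≤ n)
    (hD : Bornology.IsBounded (D : Set (EuclideanSpace ℝ (Fin n)))) {μ : ℝ}
    {u : Lp ℝ 2 (volume.restrict (D : Set (EuclideanSpace ℝ (Fin n))))} (hu : u ≠ 0)
    (h : IsDirichletEigen D μ u) : 0 < μ := by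
  obtain ⟨G, ⟨huL, hG, v, hv, hgv⟩, hweak⟩ := h
  obtain ⟨R, hRpos, hR⟩ := hD.exists_pos_norm_le
  have hvL : ∀ m, MemLp (v m) 2 (volume.restrict (D : Set (EuclideanSpace ℝ (Fin n)))) := fun m =>
    ((v m).continuous.memLp_of_hasCompactSupport (v m).hasCompactSupport).restrict _
  have hgL : ∀ m, MemLp (gradient (v m)) 2
      (volume.restrict (D : Set (EuclideanSpace ℝ (Fin n)))) := fun m =>
    ((continuous_gradient_testFunction (v m)).memLp_of_hasCompactSupport
      (hasCompactSupport_gradient_testFunction (v m))).restrict _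
  have hvt := (Lp.tendsto_Lp_iff_tendsto_eLpNorm'' _ hvL _ huL).2 hv
  have hgt := (Lp.tendsto_Lp_iff_tendsto_eLpNorm'' _ hgL _ hG).2 hgv
  rw [Lp.toLp_coeFn] at hvt
  have hpoinc : ∀ m, ‖(hvL m).toLp (v m)‖ ≤ 2 * R * ‖(hgL m).toLp (gradient (v m))‖ := by
    intro m
    refine le_of_sq_le_sq ?_ (by positivity)
    rw [mul_pow, ← real_inner_self_eq_norm_sq, ← real_inner_self_eq_norm_sq, inner_toLp_toLp,
      inner_toLp_toLp]
    simp only [real_inner_self_eq_norm_sq, Real.norm_eq_abs, sq_abs]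
    refine (integral_sq_testFunction_le hn hR (v m)).trans_eq ?_
    ring
  have hle : ‖u‖ ≤ 2 * R * ‖hG.toLp G‖ :=
    le_of_tendsto_of_tendsto' hvt.norm (hgt.norm.const_mul _) hpoinc
  -- Testing the weak equation with the approximants `v m` and passing to the limit amounts to
  -- testing with `u` itself.
  have heq : ‖hG.toLp G‖ ^ 2 = μ * ‖u‖ ^ 2 := by
    rw [← real_inner_self_eq_norm_sq, ← real_inner_self_eq_norm_sq]
    have h1 := (tendsto_const_nhds (x := hG.toLp G)).inner (𝕜 := ℝ) hgt
    have h2 := ((tendsto_const_nhds (x := u)).inner (𝕜 := ℝ) hvt).const_mul μ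
    refine tendsto_nhds_unique h1 (h2.congr fun m => ?_)
    rw [inner_toLp_toLp, hweak (v m)]
    congr 1
    rw [← Lp.toLp_coeFn u huL, inner_toLp_toLp]
    refine integral_congr_ae (ae_of_all _ fun x => ?_)
    simp [mul_comm]
  have hupos : 0 < ‖u‖ := norm_pos_iff.2 hu
  have hGpos : 0 < ‖hG.toLp G‖ := by
    by_contra hneg
    have : ‖hG.toLp G‖ = 0 := le_antisymm (not_lt.1 hneg) (norm_nonneg _)
    rw [this, mul_zero] at hle
    linarith
  by_contra hneg
  have : 0 < ‖hG.toLp G‖ ^ 2 := by positivity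
  nlinarith [sq_nonneg ‖u‖]

theorem IsDirichletEigensystem.pos (hn : 1 ≤ n)
    (hD : Bornology.IsBounded (D : Set (EuclideanSpace ℝ (Fin n)))) {lam : ℕ → ℝ}
    {φ : HilbertBasis ℕ ℝ (Lp ℝ 2 (volume.restrict (D : Set (EuclideanSpace ℝ (Fin n)))))}
    (h : IsDirichletEigensystem D lam φ) (k : ℕ) : 0 < lam k :=
  (h.eigen k).pos hn hD (φ.orthonormal.ne_zero k)

end Dirichlet

/-! ### Estimates for the Mittag-Leffler kernel and its convolutions. -/

section Kernel

variable {α μ t : ℝ}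

lemma mittagLeffler_kernel_monotoneOn (hα : α ∈ Set.Ioo (0 : ℝ) 1) (hμ : 0 ≤ μ) :
    MonotoneOn (fun r => mittagLeffler α 1 (-μ * (t - r) ^ α)) (Set.Icc 0 t) := by
  intro x hx y hy hxy
  simp only [neg_mul]
  have h1 : 0 ≤ t - x := sub_nonneg.2 hx.2
  have h2 : 0 ≤ t - y := sub_nonneg.2 hy.2
  have := hα.1.le
  refine mittagLeffler_neg_antitoneOn hα (Set.mem_Ici.2 (by positivity))
    (Set.mem_Ici.2 (by positivity)) ?_
  gcongr

lemma mittagLeffler_kernel_nonneg (hα : α ∈ Set.Ioo (0 : ℝ) 1) (hμ : 0 ≤ μ) :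
    ∀ r ∈ Set.Icc 0 t, 0 ≤ mittagLeffler α 1 (-μ * (t - r) ^ α) := by
  intro r hr
  have h1 : 0 ≤ t - r := sub_nonneg.2 hr.2
  rw [neg_mul]
  exact mittagLeffler_neg_nonneg hα (by positivity)

lemma mittagLeffler_kernel_le_one (hα : α ∈ Set.Ioo (0 : ℝ) 1) (hμ : 0 ≤ μ) :
    ∀ r ∈ Set.Icc 0 t, mittagLeffler α 1 (-μ * (t - r) ^ α) ≤ 1 := by
  intro r hr
  have h1 : 0 ≤ t - r := sub_nonneg.2 hr.2
  rw [neg_mul]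
  exact mittagLeffler_neg_le_one hα (by positivity)

lemma mittagLeffler_kernel_le_rpow (hα : α ∈ Set.Ioo (0 : ℝ) 1) (hμ : 0 < μ) {σ : ℝ}
    (hσ : σ ∈ Set.Icc (0 : ℝ) 1) : ∀ r ∈ Set.Ico 0 t,
      mittagLeffler α 1 (-μ * (t - r) ^ α) ≤ Real.exp 1 * μ ^ (-σ) * (t - r) ^ (-(α * σ)) := by
  intro r hr
  have h1 : 0 < t - r := sub_pos.2 hr.2
  rw [neg_mul]
  refine (mittagLeffler_neg_le_rpow hα (by positivity) hσ).trans_eq ?_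
  rw [Real.mul_rpow hμ.le (by positivity), ← Real.rpow_mul h1.le, mul_neg, mul_assoc]

lemma rpow_le_max_one {T p : ℝ} (ht : 0 ≤ t) (htT : t ≤ T) (hp0 : 0 ≤ p) (hp1 : p ≤ 1) :
    t ^ p ≤ max 1 T :=
  calc t ^ p ≤ (max 1 T) ^ p := by gcongr; exact htT.trans (le_max_right _ _)
    _ ≤ (max 1 T) ^ (1 : ℝ) := Real.rpow_le_rpow_of_exponent_le (le_max_left _ _) hp1
    _ = max 1 T := Real.rpow_one _

/-- The convolution of the Mittag-Leffler kernel with a bounded function. -/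
theorem mittagLeffler_convolution (hα : α ∈ Set.Ioo (0 : ℝ) 1) (hμ : 0 < μ) {T : ℝ} (ht : 0 ≤ t)
    (htT : t ≤ T) {h : ℝ → ℝ} (hm : AEStronglyMeasurable h (volume.restrict (Set.Icc 0 T))) {M : ℝ}
    (hM : ∀ᵐ r ∂volume.restrict (Set.Icc 0 T), ‖h r‖ ≤ M) (hM0 : 0 ≤ M) :
    IntervalIntegrable (fun r => mittagLeffler α 1 (-μ * (t - r) ^ α) * h r) volume 0 t ∧
    ∀ σ ∈ Set.Icc (0 : ℝ) 1, |∫ r in (0 : ℝ)..t, mittagLeffler α 1 (-μ * (t - r) ^ α) * h r| ≤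
      M * Real.exp 1 * (max 1 T / (1 - α)) * μ ^ (-σ) := by
  have hsub : Set.Ioc 0 t ⊆ Set.Icc 0 T := fun r hr => ⟨hr.1.le, hr.2.trans htT⟩
  have hM' : ∀ᵐ r ∂volume.restrict (Set.Ioc 0 t), ‖h r‖ ≤ M :=
    ae_restrict_of_ae_restrict_of_subset hsub hM
  constructor
  · rw [intervalIntegrable_iff_integrableOn_Ioc_of_le ht]
    refine MemLp.integrable (q := 2) one_le_two (MemLp.of_bound (C := M) ?_ ?_)
    · exact (aemeasurable_restrict_of_monotoneOn measurableSet_Ioc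
        ((mittagLeffler_kernel_monotoneOn hα hμ.le).mono
          Set.Ioc_subset_Icc_self)).aestronglyMeasurable.mul
        (hm.mono_measure (Measure.restrict_mono_set _ hsub))
    · filter_upwards [ae_restrict_mem measurableSet_Ioc, hM'] with r hr hrM
      have hr' := Set.Ioc_subset_Icc_self hr
      rw [norm_mul, Real.norm_of_nonneg (mittagLeffler_kernel_nonneg hα hμ.le r hr')]
      exact (mul_le_of_le_one_left (norm_nonneg _)
        (mittagLeffler_kernel_le_one hα hμ.le r hr')).trans hrM
  · intro σ hσ
    have hα0 := hα.1
    have hασ : α * σ ≤ α := mul_le_of_le_one_right hα.1.le hσ.2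
    have hα1 : 0 < 1 - α := by linarith [hα.2]
    have hp : 0 < 1 - α * σ := by linarith
    have hασ0 : 0 ≤ α * σ := mul_nonneg hα.1.le hσ.1
    -- At `r = t` the kernel is `1`, while `0 ^ (-(α * σ))` is `0` by convention when `σ > 0`, so
    -- the pointwise bound can fail there.
    have hne : ∀ᵐ r : ℝ, r ≠ t := by simp [ae_iff]
    have hb := intervalIntegral.norm_integral_le_of_norm_le (μ := volume) ht
      (f := fun r => mittagLeffler α 1 (-μ * (t - r) ^ α) * h r)
      (g := fun r => Real.exp 1 * μ ^ (-σ) * M * (t - r) ^ (-(α * σ))) ?_ ?_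
    · rw [Real.norm_eq_abs] at hb
      refine hb.trans ?_
      have hint : ∫ r in (0 : ℝ)..t, (t - r) ^ (-(α * σ)) = t ^ (1 - α * σ) / (1 - α * σ) := by
        rw [intervalIntegral.integral_comp_sub_left (fun r : ℝ => r ^ (-(α * σ))) t, sub_self,
          sub_zero, integral_rpow (Or.inl (by linarith)), neg_add_eq_sub, Real.zero_rpow hp.ne',
          sub_zero]
      rw [intervalIntegral.integral_const_mul, hint]
      have h1 : t ^ (1 - α * σ) ≤ max 1 T := rpow_le_max_one ht htT hp.le (by linarith)
      -- Uniformity in `σ` comes from `1 - ασ ≥ 1 - α`.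
      calc _ ≤ Real.exp 1 * μ ^ (-σ) * M * (max 1 T / (1 - α)) := by gcongr
        _ = _ := by ring
    · have hM'' := (ae_restrict_iff' measurableSet_Ioc).1 hM'
      filter_upwards [hne, hM''] with r hrt hrM hr
      have hr' : r ∈ Set.Ico 0 t := ⟨hr.1.le, lt_of_le_of_ne hr.2 hrt⟩
      rw [norm_mul, Real.norm_of_nonneg
        (mittagLeffler_kernel_nonneg hα hμ.le r (Set.Ico_subset_Icc_self hr'))]
      have h1 := mittagLeffler_kernel_le_rpow hα hμ hσ r hr'
      have h2 : 0 < t - r := sub_pos.2 hr'.2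
      calc _ ≤ Real.exp 1 * μ ^ (-σ) * (t - r) ^ (-(α * σ)) * M :=
            mul_le_mul h1 (hrM hr) (norm_nonneg _) (by positivity)
        _ = _ := by ring
    · have h1 : IntervalIntegrable (fun r : ℝ => r ^ (-(α * σ))) volume t 0 :=
        intervalIntegral.intervalIntegrable_rpow' (by linarith)
      have h2 := h1.comp_sub_left t
      rw [sub_self, sub_zero] at h2
      exact h2.const_mul _

end Kernel

/-- The `L²` norm of the Wiener integral of the Mittag-Leffler kernel. -/
theorem IsFBM.norm_mittagLeffler_integral_le {Ω : Type*} [MeasurableSpace Ω] {P : Measure Ω}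
    {H : ℝ} {W : ℝ≥0 → Ω → ℝ} (hW : IsFBM P H W) (hH : H ∈ Set.Ioo (0 : ℝ) 1) {α μ ε σ : ℝ}
    (hα : α ∈ Set.Ioo (0 : ℝ) 1) (hμ : 0 < μ) (hε : 0 < ε)
    (hσ : σ ∈ Set.Icc (0 : ℝ) (min (H / α - ε) 1)) {t T : ℝ≥0} (ht : 0 < t) (htT : t ≤ T)
    {J : Ω → ℝ}
    (hJ : IsWienerIntegral P W t (fun r => mittagLeffler α 1 (-μ * ((t : ℝ) - r) ^ α)) J) :
    ‖hJ.2.1.toLp J‖ ≤ Real.exp 1 * (H / (α * ε)) * max 1 (T : ℝ) * μ ^ (-σ) := by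
  have hα0 := hα.1
  have hH0 := hH.1
  have hσ1 : σ ∈ Set.Icc (0 : ℝ) 1 := ⟨hσ.1, hσ.2.trans (min_le_right _ _)⟩
  have hκ0 : 0 ≤ α * σ := mul_nonneg hα.1.le hσ.1
  have hαε : 0 < α * ε := by positivity
  -- The margin `ε` keeps the singularity exponent `κ = ασ` at distance `αε` below `H`, which bounds
  -- `H/(H-κ)` uniformly in `σ`.
  have hκ : α * ε ≤ H - α * σ := by
    have h1 : σ ≤ H / α - ε := hσ.2.trans (min_le_left _ _)
    have h2 : α * σ ≤ α * (H / α - ε) := by gcongr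
    rw [mul_sub, mul_div_cancel₀ _ hα0.ne'] at h2
    linarith
  have hb := hW.norm_toLp_le hH.1 ht (mittagLeffler_kernel_monotoneOn hα hμ.le)
    (mittagLeffler_kernel_nonneg hα hμ.le) (mittagLeffler_kernel_le_one hα hμ.le) hJ
    (B := Real.exp 1 * μ ^ (-σ)) (κ := α * σ) (by positivity) hκ0 (by linarith)
    (mittagLeffler_kernel_le_rpow hα hμ hσ1)
  refine hb.trans ?_
  have h1 : (t : ℝ) ^ (H - α * σ) ≤ max 1 (T : ℝ) :=
    rpow_le_max_one t.2 htT (by linarith) (by linarith [hH.2])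
  calc _ ≤ Real.exp 1 * μ ^ (-σ) * (H / (α * ε) * max 1 (T : ℝ)) := by gcongr
    _ = _ := by ring

end FracInverse

/-! ### The estimates for the Dirichlet eigenvalues. -/

theorem mainTheorem2
    {n : ℕ} (hn : 1 ≤ n)
    (D : TopologicalSpace.Opens (EuclideanSpace ℝ (Fin n)))
    (hDconn : IsConnected (D : Set (EuclideanSpace ℝ (Fin n))))
    (hDbdd : Bornology.IsBounded (D : Set (EuclideanSpace ℝ (Fin n))))
    (hDlip : FracInverse.HasLipschitzBoundary (D : Set (EuclideanSpace ℝ (Fin n))))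
    (lam : ℕ → ℝ)
    (φ : HilbertBasis ℕ ℝ
      (Lp ℝ 2 (volume.restrict (D : Set (EuclideanSpace ℝ (Fin n))))))
    (hφ : FracInverse.IsDirichletEigensystem D lam φ)
    (f g : Lp ℝ 2 (volume.restrict (D : Set (EuclideanSpace ℝ (Fin n)))))
    (hg : ‖g‖ ≠ 0)
    (s α H : ℝ) (hs : s ∈ Set.Ioo (0 : ℝ) 1) (hα : α ∈ Set.Ioo (0 : ℝ) 1)
    (hH : H ∈ Set.Ioo (0 : ℝ) 1)
    (T : ℝ≥0) (hT : 0 < T)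
    (h : ℝ → ℝ) (hh : MemLp h ∞ (volume.restrict (Set.Icc (0 : ℝ) T)))
    {Ω : Type*} [MeasurableSpace Ω] (P : Measure Ω) [IsProbabilityMeasure P]
    (W : ℝ≥0 → Ω → ℝ) (hW : FracInverse.IsFBM P H W) :
    -- the deterministic estimate, with a constant uniform in `t`, `k` and `σ₁`
    (∃ C : ℝ, 0 < C ∧ ∀ t : ℝ≥0, 0 < t → t ≤ T → ∀ k : ℕ,
      IntervalIntegrable
        (fun r => FracInverse.mittagLeffler α 1 (-(lam k ^ s) * ((t : ℝ) - r) ^ α) * h r)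
        volume 0 t ∧
      ∀ σ₁ ∈ Set.Icc (0 : ℝ) 1,
        |∫ r in (0 : ℝ)..t,
            FracInverse.mittagLeffler α 1 (-(lam k ^ s) * ((t : ℝ) - r) ^ α) * h r|
          ≤ C * lam k ^ (-(σ₁ * s))) ∧
    -- the stochastic integrals exist
    (∀ t : ℝ≥0, 0 < t → t ≤ T → ∀ k : ℕ, ∃ J : Ω → ℝ, FracInverse.IsWienerIntegral P W t
      (fun r => FracInverse.mittagLeffler α 1 (-(lam k ^ s) * ((t : ℝ) - r) ^ α)) J) ∧
    -- the stochastic estimate, with a constant uniform in `t`, `k`, `l` and `σ₂`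
    (∀ ε : ℝ, 0 < ε → ∃ C : ℝ, 0 < C ∧ ∀ t : ℝ≥0, 0 < t → t ≤ T → ∀ k l : ℕ, ∀ J₁ J₂ : Ω → ℝ,
      FracInverse.IsWienerIntegral P W t
        (fun r => FracInverse.mittagLeffler α 1 (-(lam k ^ s) * ((t : ℝ) - r) ^ α)) J₁ →
      FracInverse.IsWienerIntegral P W t
        (fun r => FracInverse.mittagLeffler α 1 (-(lam l ^ s) * ((t : ℝ) - r) ^ α)) J₂ →
      ∀ σ₂ ∈ Set.Icc (0 : ℝ) (min (H / α - ε) 1),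
        ∫ ω, J₁ ω * J₂ ω ∂P ≤ C * lam k ^ (-(σ₂ * s)) * lam l ^ (-(σ₂ * s))) := by
  have hlam : ∀ k, 0 < lam k := hφ.pos hn hDbdd
  have hμ : ∀ k, 0 < lam k ^ s := fun k => Real.rpow_pos_of_pos (hlam k) s
  have hpow : ∀ k σ, (lam k ^ s) ^ (-σ) = lam k ^ (-(σ * s)) := fun k σ => by
    rw [← Real.rpow_mul (hlam k).le]
    ring_nf
  have hα1 : 0 < 1 - α := by linarith [hα.2]
  have hmax : (0 : ℝ) < max 1 (T : ℝ) := lt_max_of_lt_left one_pos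
  refine ⟨?_, fun t ht _ k => ?_, fun ε hε => ?_⟩
  -- Adding `1` keeps the constant positive even if `h = 0` almost everywhere.
  · set M : ℝ := (eLpNorm h ∞ (volume.restrict (Set.Icc (0 : ℝ) T))).toReal + 1 with hMdef
    have hM0 : 0 < M := by positivity
    have hM : ∀ᵐ r ∂volume.restrict (Set.Icc (0 : ℝ) T), ‖h r‖ ≤ M := by
      filter_upwards [ae_le_eLpNormEssSup (f := h)
        (μ := volume.restrict (Set.Icc (0 : ℝ) T))] with r hr
      rw [← eLpNorm_exponent_top] at hr
      have h1 := ENNReal.toReal_mono hh.2.ne hr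
      rw [toReal_enorm] at h1
      linarith
    refine ⟨M * Real.exp 1 * (max 1 (T : ℝ) / (1 - α)), by positivity, fun t _ htT k => ?_⟩
    have h1 := FracInverse.mittagLeffler_convolution hα (hμ k) t.2 (NNReal.coe_le_coe.2 htT)
      hh.1 hM hM0.le
    refine ⟨h1.1, fun σ hσ => ?_⟩
    rw [← hpow]
    exact h1.2 σ hσ
  · exact hW.exists_isWienerIntegral hH.1 ht
      (FracInverse.mittagLeffler_kernel_monotoneOn hα (hμ k).le)
      (FracInverse.mittagLeffler_kernel_nonneg hα (hμ k).le)
      (FracInverse.mittagLeffler_kernel_le_one hα (hμ k).le)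
  · have hα0 := hα.1
    have hH0 := hH.1
    set K : ℝ := Real.exp 1 * (H / (α * ε)) * max 1 (T : ℝ) with hK
    have hK0 : 0 < K := by positivity
    refine ⟨K * K, by positivity, fun t ht htT k l J₁ J₂ hJ₁ hJ₂ σ hσ => ?_⟩
    have h1 := hW.norm_mittagLeffler_integral_le hH hα (hμ k) hε hσ ht htT hJ₁
    have h2 := hW.norm_mittagLeffler_integral_le hH hα (hμ l) hε hσ ht htT hJ₂
    rw [hpow, ← hK] at h1 h2
    -- The expectation is an inner product in `L²(Ω)`, so Cauchy–Schwarz reduces it to the two norm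
    -- bounds.
    have h3 : ∫ ω, J₁ ω * J₂ ω ∂P = inner ℝ (hJ₁.2.1.toLp J₁) (hJ₂.2.1.toLp J₂) := by
      rw [FracInverse.inner_toLp_toLp]
      refine integral_congr_ae (ae_of_all _ fun ω => ?_)
      simp [mul_comm]
    rw [h3]
    have hpos := (hlam k).le
    calc _ ≤ ‖hJ₁.2.1.toLp J₁‖ * ‖hJ₂.2.1.toLp J₂‖ := real_inner_le_norm _ _
      _ ≤ (K * lam k ^ (-(σ * s))) * (K * lam l ^ (-(σ * s))) := by gcongr
      _ = _ := by ring
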